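/- **Conventions.** Elements of a set are inputs and outputs of algorithms through names: a set is *coded* if there is an effectively enumerable type of finite names and each element of the set has at least one name (possibly several); an algorithm is a computable function of names. For a group $G$ acting on a set $X$ put $G_x=\{g\in G\mid gx=x\}$. **Definition.** Let $G$ be a coded group and $X$ a coded $G$-set. A *presentation family* for the action of $G$ on $X$ consists of a simplicial complex $L$ with coded vertex set, a simplicial, properly discontinuous action of $G$ on $L$ that inverts no edge of $L$, and, for each $x\in X$, a contractible $G_x$-invariant subcomplex $L_x$ of $L$, such that: 1. there is an algorithm that decides, for $g_1,g_2,g_3\in G$, whether $g_1g_2=g_3$; 2. there is an algorithm that decides, for $g\in G$ and $x_1,x_2\in X$, whether $gx_1=x_2$; 3. there is an algorithm that takes as input vertices $v,w$ of $L$, decides whether there is $g\in G$ with $gv=w$, and if so outputs the finite set $G_{v,w}=\{g\in G\mid gv=w\}$; 4. there is an algorithm that takes as input $x\in X$ and outputs (as a finite list of simplices, each given by its vertices) a finite subcomplex $D_x$ of $L_x$ with $G_xD_x=L_x$; 5. $g(L_x)=L_{gx}$ for all $g\in G$ and $x\in X$. A group is *of type $\mathsf{VF}$* if it has a subgroup of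 finite index that has a finite Eilenberg–MacLane space, that is, that is isomorphic to the fundamental group of a connected finite CW complex with vanishing higher homotopy groups. **Proposition.** Suppose that the coded $G$-set $X$ has a presentation family and that $G$ has a torsion-free subgroup of finite index. Then there are algorithms that take as input $x,y\in X$ and output 1. YES or NO depending on whether or not there is $g\in G$ such that $gx=y$, together with such a $g$ if one exists; 2. a finite presentation of $G_x$: a finite list of elements of $G$ that generate $G_x$, and a finite list of words in these generators whose normal closure is the kernel of the resulting surjection from the free group onto $G_x$. Further, $G_x$ is of type $\mathsf{VF}$ for every $x\in X$. -/

import Mathlib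

namespace GFP

universe u v w

/-- A way of naming the elements of a set by finite data, so that they can be inputs and outputs of
algorithms: every element has at least one name, and an element may have several names. The names
form an effectively given type (`Primcodable`), so they can be listed by a machine. -/
structure Coding (A : Type u) where
  /-- the type of names -/
  Code : Type
  [primcodable : Primcodable Code]
  /-- the element that has a given name -/
  elt : Code → A
  surjective_elt : Function.Surjective elt

attribute [instance] Coding.primcodable

/-! ### The geometric realization of a simplicial complex -/

section Realization

variable {V : Type v}

/-- The points of the geometric realization `|K|`, given by their barycentric coordinates. -/
@[ext]
structure Realization (K : PreAbstractSimplicialComplex V) where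
  /-- the barycentric coordinates -/
  weight : V →₀ ℝ
  weight_nonneg : ∀ a, 0 ≤ weight a
  support_mem : weight.support ∈ K.faces
  sum_weight : (weight.sum fun _ t => t) = 1

open Classical in
/-- The inclusion into `|K|` of the closed simplex spanned by a face `s` of `K`. -/
noncomputable def simplexMap (K : PreAbstractSimplicialComplex V) (s : K.faces) :
    stdSimplex ℝ s.1 → Realization K := fun p =>
  { weight := Finsupp.onFinset s.1 (fun a => if h : a ∈ s.1 then p.1 ⟨a, h⟩ else 0)
      (by intro a ha; by_contra h; simp [h] at ha)
    weight_nonneg := by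
      intro a
      simp only [Finsupp.onFinset_apply]
      split_ifs with h
      · exact p.2.1 _
      · exact le_rfl
    support_mem := by
      have hsum : ∑ x : s.1, p.1 x = 1 := p.2.2
      refine (K.isRelLowerSet_faces s.2).2 Finsupp.support_onFinset_subset ?_
      by_contra hne
      rw [Finset.not_nonempty_iff_eq_empty, Finsupp.support_eq_empty] at hne
      have h0 : ∀ x : s.1, p.1 x = 0 := by
        intro x
        have := DFunLike.congr_fun hne x.1
        simpa using this
      simp [h0] at hsum
    sum_weight := by
      have hsum : ∑ x : s.1, p.1 x = 1 := p.2.2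
      rw [Finsupp.onFinset_sum _ (fun _ => rfl), ← Finset.sum_attach, ← hsum]
      exact Finset.sum_congr rfl fun x _ => by simp }

/-- The weak (coherent) topology on `|K|`: a set is closed if and only if its intersection with
every closed simplex is closed in the Euclidean topology of that simplex. -/
noncomputable instance (K : PreAbstractSimplicialComplex V) : TopologicalSpace (Realization K) :=
  ⨆ s : K.faces, TopologicalSpace.coinduced (simplexMap K s) inferInstance

end Realization

/-- The image `g s` of a finite set of vertices `s`. -/
def faceImage {G : Type u} {V : Type v} [Group G] [MulAction G V] (g : G) (s : Finset V) :
    Finset V :=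
  s.map (MulAction.toPerm g).toEmbedding

/-- A presentation family for the action of `G` on `X`, where the elements of `G` and `X` are given
to algorithms through the codings `cG` and `cX`. -/
structure PresentationFamily {G : Type u} {X : Type w} [Group G] [MulAction G X]
    (cG : Coding G) (cX : Coding X) where
  /-- It is decidable whether `g₁ g₂ = g₃`. -/
  mul_decidable : ComputablePred fun t : cG.Code × cG.Code × cG.Code =>
    cG.elt t.1 * cG.elt t.2.1 = cG.elt t.2.2
  /-- It is decidable whether `g x₁ = x₂`. -/
  smul_decidable : ComputablePred fun t : cG.Code × cX.Code × cX.Code =>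
    cG.elt t.1 • cX.elt t.2.1 = cX.elt t.2.2
  /-- the vertices of `L` -/
  V : Type v
  /-- the simplicial complex `L`; every element of `V` is a vertex of it -/
  L : AbstractSimplicialComplex V
  /-- the action of `G` on `L`, given by its effect on the vertices -/
  [action : MulAction G V]
  /-- The action is simplicial. -/
  faceImage_mem : ∀ (g : G) (s : Finset V), s ∈ L.faces → faceImage g s ∈ L.faces
  /-- The action is properly discontinuous: if `C` is a compact subset of `|L|`, then `gC` meets `C`
  for only finitely many `g`. (A point `q` is `g p` if and only if the barycentric coordinate of
  `q` at each `g a` is that of `p` at `a`.) -/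
  properlyDiscontinuous : ∀ C : Set (Realization L.toPreAbstractSimplicialComplex), IsCompact C →
    {g : G | ∃ p ∈ C, ∃ q ∈ C, ∀ a : V, q.weight (g • a) = p.weight a}.Finite
  /-- No edge is inverted. -/
  no_inversion : ∀ (g : G) (a b : V) (s : Finset V), s ∈ L.faces → (s : Set V) = {a, b} → a ≠ b →
    ¬ (g • a = b ∧ g • b = a)
  /-- names for the vertices of `L` -/
  cV : Coding V
  /-- the algorithm that lists, for two vertices `a` and `b`, the elements `g` with `g a = b`;
  the list is empty if there are none -/
  transporter : cV.Code × cV.Code → List cG.Code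
  transporter_computable : Computable transporter
  transporter_spec : ∀ (a b : cV.Code) (g : G),
    g • cV.elt a = cV.elt b ↔ ∃ c ∈ transporter (a, b), cG.elt c = g
  /-- the subcomplexes `L_x` of `L` -/
  sub : X → PreAbstractSimplicialComplex V
  sub_le : ∀ x, sub x ≤ L.toPreAbstractSimplicialComplex
  sub_contractible : ∀ x, ContractibleSpace (Realization (sub x))
  /-- the algorithm that finds a finite fundamental domain: the output is the list of the simplices
  of `D_x`, each of them given by the list of its vertices -/
  domain : cX.Code → List (List cV.Code)
  domain_computable : Computable domain
  /-- the fundamental domain `D_x` as a simplicial complex -/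
  dom : cX.Code → PreAbstractSimplicialComplex V
  dom_spec : ∀ (x : cX.Code) (s : Finset V),
    s ∈ (dom x).faces ↔ ∃ l ∈ domain x, ∀ a : V, a ∈ s ↔ ∃ c ∈ l, cV.elt c = a
  dom_le : ∀ x : cX.Code, dom x ≤ sub (cX.elt x)
  /-- `G_x D_x = L_x`. -/
  dom_covers : ∀ (x : cX.Code) (s : Finset V), s ∈ (sub (cX.elt x)).faces ↔
    ∃ g ∈ MulAction.stabilizer G (cX.elt x), ∃ t ∈ (dom x).faces, s = faceImage g t
  /-- `g L_x = L_{g x}`; with `g` in `G_x` this says that `L_x` is `G_x`-invariant. -/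
  sub_smul : ∀ (g : G) (x : X), (sub (g • x)).faces = faceImage g '' (sub x).faces

/-- `gens` and `rels` form a finite presentation of the subgroup `S` of `G`, on generators that are
given as elements of `G`. A relator is a word in the generators: the letter `(i, true)` stands for
the `i`-th generator and `(i, false)` for its inverse (counting from `0`). -/
def IsFinitePresentation {G : Type u} [Group G] (S : Subgroup G) (gens : List G)
    (rels : List (List (ℕ × Bool))) : Prop :=
  (∀ r ∈ rels, ∀ p ∈ r, p.1 < gens.length) ∧
  (FreeGroup.lift gens.get).range = S ∧
  (FreeGroup.lift gens.get).ker = Subgroup.normalClosure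
    {r : FreeGroup (Fin gens.length) | ∃ l : List (Fin gens.length × Bool),
      l.map (fun p => ((p.1 : ℕ), p.2)) ∈ rels ∧ FreeGroup.mk l = r}

/-- `H` has a finite Eilenberg–MacLane space: a connected finite CW complex whose fundamental group
is isomorphic to `H` and whose higher homotopy groups vanish. (Such a space has at most continuum
many points, so that `Type` is large enough.) -/
def HasFiniteEilenbergMacLane (H : Type u) [Group H] : Prop :=
  ∃ (Y : Type) (_ : TopologicalSpace Y) (_ : Topology.CWComplex (Set.univ : Set Y)) (y : Y),
    T2Space Y ∧ Topology.CWComplex.Finite (Set.univ : Set Y) ∧ PathConnectedSpace Y ∧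
    Nonempty (FundamentalGroup Y y ≃* H) ∧
    ∀ n : ℕ, 2 ≤ n → Subsingleton (HomotopyGroup.Pi n Y y)

/-- Type `VF`: some subgroup of finite index has a finite Eilenberg–MacLane space. -/
def IsTypeVF (Γ : Type u) [Group Γ] : Prop :=
  ∃ H : Subgroup Γ, H.FiniteIndex ∧ HasFiniteEilenbergMacLane H

/-- Some subgroup of finite index is torsion-free: its only element of finite order is `1`. -/
def IsVirtuallyTorsionFree (G : Type u) [Group G] : Prop :=
  ∃ H : Subgroup G, H.FiniteIndex ∧ ∀ g ∈ H, IsOfFinOrder g → g = 1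

end GFP

/-!
The group `G_x` acts on the contractible complex `L_x` with finitely many orbits of simplices and
with finite vertex transporters, and everything follows from this action.

*Algorithms.* All algorithms are unbounded searches (`exists_computable_choice`) for an output
that is known to exist and whose correctness is a decidable property. Decidability is always
obtained by writing the property with quantifiers over finite lists that the presentation family
computes, so that closure of `ComputablePred` under bounded quantification is all the recursion
theory needed.

If `g x = y` and `v` is a vertex of `D_x`, then `g v` is a vertex of `L_y`, and after multiplying
`g` by an element of `G_y` it is a vertex `w` of `D_y`. Hence `x` and `y` are in the same orbit if
and only if one of the finitely many elements of the sets `G_{v,w}`, with `w` in `D_y`, maps `x`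
to `y`.

For the presentation, choose a finite set `W` of vertices of `L_x` that is connected by edges of
`L_x` and meets every orbit of vertices. Macbeath's theorem (`presentation_of_connected`) says
that `G_x` is generated by the finite set of those `g` for which `W` and `g W` contain adjacent
vertices, and that the valid products `s t = u` of these generators are a complete set of
relations. Its proof uses simple connectivity in the form that a cocycle on the edges of `L_x`,
with values in any group, is a coboundary (`exists_coboundary`): the cocycle defines a covering of
the realization, and the homotopy lifting property gives a section because the realization is
contractible. The cocycle to which this is applied takes its values in the abstractly presented
group; its potential inverts the map onto `G_x`.

*Type `VF`.* Let `Γ` be the intersection of `G_x` with a torsion-free subgroup of finite index. It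
has finite index in `G_x`, and it acts freely on `|L_x|`, because an element that preserves a
simplex has finite order. The quotient `Y` is a Hausdorff space, the quotient map is a covering
with group `Γ` (`isQuotientCoveringMap_mk`), and `Y` is a finite CW complex with one cell for each
orbit of simplices (`exists_finite_cwComplex`). As the covering space `|L_x|` is contractible, `Y`
has fundamental group `Γ` and trivial higher homotopy groups. For the latter, a map of a cube of
dimension at least two, constant on the boundary, lifts to a map of the same kind, and this is
trivial relative to the boundary because a map from a sphere to a contractible space extends to
the ball (`genLoop_homotopic_const`).
-/

/-! ### Closure properties of decidable predicates, and unbounded search -/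

section Computability

variable {α β : Type*} [Primcodable α] [Primcodable β]

theorem computablePred_of_bool {p : α → Prop} (f : α → Bool) (hf : Computable f)
    (h : ∀ a, f a = true ↔ p a) : ComputablePred p :=
  ComputablePred.computable_iff.2 ⟨f, hf, funext fun a => propext (h a).symm⟩

theorem ComputablePred.exists_bool {p : α → Prop} (hp : ComputablePred p) :
    ∃ f : α → Bool, Computable f ∧ ∀ a, f a = true ↔ p a := by
  obtain ⟨f, hf, rfl⟩ := ComputablePred.computable_iff.1 hp
  exact ⟨f, hf, fun a => Iff.rfl⟩

theorem ComputablePred.comp {p : β → Prop} (hp : ComputablePred p) {f : α → β}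
    (hf : Computable f) : ComputablePred fun a => p (f a) := by
  obtain ⟨g, hg, h⟩ := ComputablePred.exists_bool hp
  exact computablePred_of_bool _ (hg.comp hf) fun a => h (f a)

theorem ComputablePred.conj {p q : α → Prop} (hp : ComputablePred p) (hq : ComputablePred q) :
    ComputablePred fun a => p a ∧ q a := by
  obtain ⟨f, hf, h⟩ := ComputablePred.exists_bool hp
  obtain ⟨g, hg, h'⟩ := ComputablePred.exists_bool hq
  exact computablePred_of_bool _ (Primrec.and.to_comp.comp hf hg) fun a => by
    simp [← h, ← h']

theorem ComputablePred.neg {p : α → Prop} (hp : ComputablePred p) :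
    ComputablePred fun a => ¬ p a := by
  obtain ⟨f, hf, h⟩ := ComputablePred.exists_bool hp
  exact computablePred_of_bool _ (Primrec.not.to_comp.comp hf) fun a => by
    simp [← h]

theorem ComputablePred.disj {p q : α → Prop} (hp : ComputablePred p) (hq : ComputablePred q) :
    ComputablePred fun a => p a ∨ q a :=
  ((hp.neg.conj hq.neg).neg).of_eq fun a => by tauto

theorem ComputablePred.imp {p q : α → Prop} (hp : ComputablePred p) (hq : ComputablePred q) :
    ComputablePred fun a => p a → q a :=
  (hp.neg.disj hq).of_eq fun a => by tauto

/-- Equality of codes is compared through their Gödel numbers, so no `DecidableEq` is needed. -/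
theorem ComputablePred.eq {f g : α → β} (hf : Computable f) (hg : Computable g) :
    ComputablePred fun a => f a = g a := by
  classical
  refine computablePred_of_bool (fun a => decide (Encodable.encode (f a) = Encodable.encode (g a)))
    ?_ fun a => by simp
  exact (Primrec.eq (α := ℕ)).decide.to_comp.comp (Computable.encode.comp hf)
    (Computable.encode.comp hg)

theorem ComputablePred.forall_mem_option {o : α → Option β} (ho : Computable o)
    {p : α → β → Prop} (hp : ComputablePred fun x : α × β => p x.1 x.2) :
    ComputablePred fun a => ∀ b ∈ o a, p a b := by
  obtain ⟨f, hf, h⟩ := ComputablePred.exists_bool hp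
  refine computablePred_of_bool _ (Computable.option_casesOn (g := fun a b => f (a, b)) ho
    (Computable.const true) hf) fun a => ?_
  cases ho' : o a <;> simp [h]

theorem ComputablePred.forall_lt {n : α → ℕ} (hn : Computable n)
    {p : α → ℕ → Prop} (hp : ComputablePred fun x : α × ℕ => p x.1 x.2) :
    ComputablePred fun a => ∀ i < n a, p a i := by
  obtain ⟨f, hf, h⟩ := ComputablePred.exists_bool hp
  have hstep : Computable₂ fun (a : α) (x : ℕ × Bool) => x.2 && f (a, x.1) :=
    Primrec.and.to_comp.comp (Computable.snd.comp Computable.snd)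
      (hf.comp (Computable.pair Computable.fst (Computable.fst.comp Computable.snd)))
  refine computablePred_of_bool _ (Computable.nat_rec hn (Computable.const true) hstep) fun a => ?_
  induction n a with
  | zero => simp
  | succ k ih =>
    simp only [Bool.and_eq_true, ih, h, Nat.lt_succ_iff_lt_or_eq]
    constructor
    · rintro ⟨h1, h2⟩ i (hi | rfl)
      exacts [h1 i hi, h2]
    · exact fun H => ⟨fun i hi => H i (Or.inl hi), H k (Or.inr rfl)⟩

theorem ComputablePred.exists_lt {n : α → ℕ} (hn : Computable n)
    {p : α → ℕ → Prop} (hp : ComputablePred fun x : α × ℕ => p x.1 x.2) :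
    ComputablePred fun a => ∃ i < n a, p a i :=
  (ComputablePred.forall_lt hn (p := fun a i => ¬ p a i) hp.neg).neg.of_eq fun a => by
    push Not; rfl

theorem ComputablePred.exists_mem_option {o : α → Option β} (ho : Computable o)
    {p : α → β → Prop} (hp : ComputablePred fun x : α × β => p x.1 x.2) :
    ComputablePred fun a => ∃ b ∈ o a, p a b :=
  (ComputablePred.forall_mem_option ho (p := fun a i => ¬ p a i) hp.neg).neg.of_eq fun a => by
    push Not; rfl

theorem ComputablePred.forall_mem_list {l : α → List β} (hl : Computable l)
    {p : α → β → Prop} (hp : ComputablePred fun x : α × β => p x.1 x.2) :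
    ComputablePred fun a => ∀ b ∈ l a, p a b := by
  have h1 : ComputablePred fun x : α × ℕ => ∀ b ∈ (l x.1)[x.2]?, p x.1 b :=
    ComputablePred.forall_mem_option
      (Computable.list_getElem?.comp (hl.comp Computable.fst) Computable.snd)
      (hp.comp (Computable.pair (Computable.fst.comp Computable.fst) Computable.snd))
  refine (ComputablePred.forall_lt (Computable.list_length.comp hl)
    (p := fun a n => ∀ b ∈ (l a)[n]?, p a b) h1).of_eq fun a => ?_
  constructor
  · intro H b hb
    obtain ⟨i, hi, rfl⟩ := List.getElem_of_mem hb
    exact H i hi _ (by simp [hi])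
  · intro H i hi b hb
    exact H b (List.mem_of_getElem? hb)

theorem ComputablePred.exists_mem_list {l : α → List β} (hl : Computable l)
    {p : α → β → Prop} (hp : ComputablePred fun x : α × β => p x.1 x.2) :
    ComputablePred fun a => ∃ b ∈ l a, p a b :=
  (ComputablePred.forall_mem_list hl (p := fun a i => ¬ p a i) hp.neg).neg.of_eq fun a => by
    push Not; rfl

/-- Unbounded search: a decidable relation that is total has a computable choice function. -/
theorem exists_computable_choice {R : α → β → Prop}
    (hR : ComputablePred fun x : α × β => R x.1 x.2) (h : ∀ a, ∃ b, R a b) :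
    ∃ f : α → β, Computable f ∧ ∀ a, R a (f a) := by
  obtain ⟨r, hr, hr'⟩ := ComputablePred.exists_bool hR
  let F : α → ℕ → Option β := fun a n =>
    (Encodable.decode (α := β) n).bind fun b => bif r (a, b) then some b else none
  have hF : Computable₂ F := by
    refine Computable.option_bind (Computable.decode.comp Computable.snd) ?_
    refine Computable.cond (hr.comp (Computable.pair (Computable.fst.comp Computable.fst)
      Computable.snd)) (Computable.option_some.comp Computable.snd) (Computable.const none)
  have hp := Partrec.rfindOpt hF
  have hspec : ∀ a b n, b ∈ F a n → R a b := by
    intro a b n hb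
    simp only [F, Option.mem_def, Option.bind_eq_some_iff] at hb
    obtain ⟨c, -, hc⟩ := hb
    cases hrc : r (a, c) <;> rw [hrc] at hc <;> simp at hc
    subst hc
    exact (hr' (a, c)).1 hrc
  have hdom : ∀ a, (Nat.rfindOpt (F a)).Dom := by
    intro a
    rw [Nat.rfindOpt_dom]
    obtain ⟨b, hb⟩ := h a
    refine ⟨Encodable.encode b, b, ?_⟩
    simp [F, (hr' (a, b)).2 hb]
  refine ⟨fun a => (Nat.rfindOpt (F a)).get (hdom a), ?_, fun a => ?_⟩
  · refine hp.of_eq fun a => ?_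
    exact (Part.some_get (hdom a)).symm
  · obtain ⟨n, hn⟩ := Nat.rfindOpt_spec (Part.get_mem (hdom a))
    exact hspec _ _ _ hn

end Computability

namespace GFP
open Set Topology unitInterval

universe v
variable {V : Type v} {K : PreAbstractSimplicialComplex V}

/-! ### The geometric realization -/

namespace Realization

theorem continuous_iff {Z : Type*} [TopologicalSpace Z] {f : Realization K → Z} :
    Continuous f ↔ ∀ s : K.faces, Continuous (f ∘ simplexMap K s) := by
  simp only [continuous_iSup_dom, continuous_coinduced_dom]

theorem continuous_simplexMap (s : K.faces) : Continuous (simplexMap K s) :=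
  continuous_iff.1 continuous_id s

open Classical in
theorem simplexMap_weight (s : K.faces) (q : stdSimplex ℝ s.1) (a : V) :
    (simplexMap K s q).weight a = if h : a ∈ s.1 then q.1 ⟨a, h⟩ else 0 := rfl

theorem simplexMap_weight_of_mem (s : K.faces) (q : stdSimplex ℝ s.1) {a : V} (h : a ∈ s.1) :
    (simplexMap K s q).weight a = q.1 ⟨a, h⟩ := by
  rw [simplexMap_weight, dif_pos h]

theorem support_simplexMap_subset (s : K.faces) (q : stdSimplex ℝ s.1) :
    (simplexMap K s q).weight.support ⊆ s.1 := by
  intro a ha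
  by_contra h
  simp [simplexMap_weight, h] at ha

theorem sum_weight_eq (p : Realization K) {s : Finset V} (hs : p.weight.support ⊆ s) :
    ∑ a ∈ s, p.weight a = 1 := by
  rw [← p.sum_weight, Finsupp.sum_of_support_subset _ hs _ (fun _ _ => rfl)]

theorem exists_simplexMap_eq (p : Realization K) (s : K.faces) (hs : p.weight.support ⊆ s.1) :
    ∃ q, simplexMap K s q = p := by
  refine ⟨⟨fun a => p.weight a, fun a => p.weight_nonneg a, ?_⟩, ?_⟩
  · rw [← sum_weight_eq p hs]
    exact Finset.sum_coe_sort s.1 fun a => p.weight a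
  · ext a
    rw [simplexMap_weight]
    split_ifs with h
    · rfl
    · by_contra hne
      exact h (hs (Finsupp.mem_support_iff.2 (Ne.symm hne)))

theorem support_nonempty (p : Realization K) : p.weight.support.Nonempty :=
  K.isRelLowerSet_faces.prop_of_mem p.support_mem

theorem weight_pos (p : Realization K) {a : V} (h : a ∈ p.weight.support) : 0 < p.weight a :=
  lt_of_le_of_ne (p.weight_nonneg a) (Finsupp.mem_support_iff.1 h).symm

theorem continuous_weight (a : V) : Continuous fun p : Realization K => p.weight a := by
  classical
  rw [continuous_iff]
  intro s
  by_cases h : a ∈ s.1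
  · have : (fun p : Realization K => p.weight a) ∘ simplexMap K s
        = fun q => q.1 ⟨a, h⟩ := by
      funext q; simp [simplexMap_weight, h]
    rw [this]
    exact (continuous_apply _).comp continuous_subtype_val
  · have : (fun p : Realization K => p.weight a) ∘ simplexMap K s = fun _ => 0 := by
      funext q; simp [simplexMap_weight, h]
    rw [this]
    exact continuous_const

/-- The open star of a vertex. -/
def star (a : V) : Set (Realization K) := {p | 0 < p.weight a}

theorem isOpen_star (a : V) : IsOpen (star a : Set (Realization K)) :=
  isOpen_lt continuous_const (continuous_weight a)

end Realization

/-! ### Connectedness and first cohomology -/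

/-- Two vertices of `K` are adjacent if some face contains both; a vertex is adjacent to itself. -/
def Adj (K : PreAbstractSimplicialComplex V) (a b : V) : Prop := ∃ s ∈ K.faces, a ∈ s ∧ b ∈ s

/-- In a complex with connected realization, a set of vertices that is closed under adjacency and
contains some vertex contains all vertices. -/
theorem mem_of_adj_closed [PreconnectedSpace (Realization K)] (S : Set V)
    (hS : ∀ a b, Adj K a b → a ∈ S → b ∈ S) {a b : V} (ha : a ∈ S) (haK : Adj K a a)
    (hbK : Adj K b b) : b ∈ S := by
  classical
  let f : Realization K → Bool := fun p => decide (∃ a ∈ p.weight.support, a ∈ S)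
  have key : ∀ (s : K.faces) (q : stdSimplex ℝ s.1),
      f (simplexMap K s q) = decide (∃ a ∈ s.1, a ∈ S) := by
    intro s q
    simp only [f, decide_eq_decide]
    constructor
    · rintro ⟨c, hc, hcS⟩
      exact ⟨c, Realization.support_simplexMap_subset s q hc, hcS⟩
    · rintro ⟨c, hc, hcS⟩
      obtain ⟨d, hd⟩ := (simplexMap K s q).support_nonempty
      exact ⟨d, hd, hS c d ⟨s.1, s.2, hc, Realization.support_simplexMap_subset s q hd⟩ hcS⟩
  have hf : Continuous f := by
    rw [Realization.continuous_iff]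
    intro s
    rw [show f ∘ simplexMap K s = fun _ => decide (∃ a ∈ s.1, a ∈ S) from funext (key s)]
    exact continuous_const
  obtain ⟨s, hs, has, -⟩ := haK
  obtain ⟨t, ht, hbt, -⟩ := hbK
  let p := simplexMap K ⟨s, hs⟩ (stdSimplex.vertex (S := ℝ) (⟨a, has⟩ : s))
  let q := simplexMap K ⟨t, ht⟩ (stdSimplex.vertex (S := ℝ) (⟨b, hbt⟩ : t))
  have hpq : f p = f q := PreconnectedSpace.constant ‹_› hf
  rw [show f p = _ from key _ _, show f q = _ from key _ _, decide_eq_decide] at hpq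
  obtain ⟨d, hd, hdS⟩ := hpq.1 ⟨a, has, ha⟩
  exact hS d b ⟨t, ht, hd, hbt⟩ hdS

open Realization in
/-- The bundle over the realization, with the discrete group `A` as fibre, whose transition
functions over the open stars are the right multiplications by the values of the cocycle `c`. -/
noncomputable def cocycleBundle {A : Type*} [Group A] [TopologicalSpace A] [DiscreteTopology A]
    (K : PreAbstractSimplicialComplex V) (c : V → V → A)
    (hc : ∀ s ∈ K.faces, ∀ a ∈ s, ∀ b ∈ s, ∀ d ∈ s, c a b * c b d = c a d) :
    FiberBundleCore V (Realization K) A where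
  baseSet := star
  isOpen_baseSet := isOpen_star
  indexAt p := p.support_nonempty.choose
  mem_baseSet_at p := p.weight_pos p.support_nonempty.choose_spec
  coordChange a b _ x := x * c a b
  coordChange_self a p hp x := by
    have ha : a ∈ p.weight.support := Finsupp.mem_support_iff.2 (ne_of_gt hp)
    have := hc _ p.support_mem a ha a ha a ha
    rw [mul_eq_left] at this
    rw [this, mul_one]
  continuousOn_coordChange a b :=
    ((continuous_of_discreteTopology (f := fun x : A => x * c a b)).comp
      continuous_snd).continuousOn
  coordChange_comp a b d p hp x := by
    have ha : a ∈ p.weight.support := Finsupp.mem_support_iff.2 (ne_of_gt hp.1.1)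
    have hb : b ∈ p.weight.support := Finsupp.mem_support_iff.2 (ne_of_gt hp.1.2)
    have hd : d ∈ p.weight.support := Finsupp.mem_support_iff.2 (ne_of_gt hp.2)
    rw [mul_assoc, hc _ p.support_mem a ha b hb d hd]

/-- A covering of a contractible space has a continuous section. -/
theorem _root_.IsCoveringMap.exists_section {E B : Type*} [TopologicalSpace E] [TopologicalSpace B]
    [ContractibleSpace B] {p : E → B} (hp : IsCoveringMap p) (hs : Function.Surjective p) :
    ∃ f : C(B, E), ∀ b, p (f b) = b := by
  obtain ⟨b₀, ⟨F⟩⟩ := id_nullhomotopic B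
  obtain ⟨e₀, he₀⟩ := hs b₀
  let F' := F.symm
  let G : C(I × B, B) := F'.toContinuousMap
  have hG : ∀ b, G (0, b) = p ((ContinuousMap.const B e₀) b) := by
    intro b; simp [G, F', he₀]
  refine ⟨(hp.liftHomotopy G _ hG).comp ((ContinuousMap.const B 1).prodMk (ContinuousMap.id B)),
    fun b => ?_⟩
  have := congrFun (hp.liftHomotopy_lifts G _ hG) (1, b)
  simp only [Function.comp_apply] at this
  exact this.trans (by simp [G, F'])

namespace Realization

open Classical in
/-- Inside a face `s`, the straight path from a point to a vertex of `s` of positive weight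
stays in the open star of this vertex. -/
theorem isPreconnected_segment_star (s : K.faces) (q : stdSimplex ℝ s.1) (a : s.1)
    (ha : 0 < q.1 a) : ∃ S : Set (Realization K), IsPreconnected S ∧ S ⊆ star a.1 ∧
      simplexMap K s q ∈ S ∧ simplexMap K s (stdSimplex.vertex (S := ℝ) a) ∈ S := by
  have hconv : Convex ℝ ({f : s.1 → ℝ | 0 < f a} ∩ stdSimplex ℝ s.1) := by
    refine Convex.inter ?_ (convex_stdSimplex ℝ _)
    exact convex_halfSpace_gt (IsLinearMap.mk (fun _ _ => rfl) (fun _ _ => rfl)) 0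
  refine ⟨simplexMap K s '' (Subtype.val ⁻¹' {f : s.1 → ℝ | 0 < f a}), ?_, ?_, ⟨q, ha, rfl⟩,
    ⟨_, ?_, rfl⟩⟩
  · refine IsPreconnected.image ?_ _ (continuous_simplexMap s).continuousOn
    rw [← IsInducing.subtypeVal.isPreconnected_image, image_preimage_eq_inter_range,
      Subtype.range_coe]
    exact hconv.isPreconnected
  · rintro _ ⟨r, hr, rfl⟩
    change 0 < (simplexMap K s r).weight a
    rw [simplexMap_weight_of_mem s r a.2]
    exact hr
  · change 0 < (stdSimplex.vertex (S := ℝ) a).1 a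
    simp

end Realization

open Realization in
/-- A complex with contractible realization has no nontrivial first cohomology, with
coefficients in any group. -/
theorem exists_coboundary [ContractibleSpace (Realization K)] {A : Type*} [Group A]
    (c : V → V → A)
    (hc : ∀ s ∈ K.faces, ∀ a ∈ s, ∀ b ∈ s, ∀ d ∈ s, c a b * c b d = c a d) :
    ∃ f : V → A, ∀ a b, Adj K a b → f a * c a b = f b := by
  classical
  let _ : TopologicalSpace A := ⊥
  have _ : DiscreteTopology A := ⟨rfl⟩
  let Z := cocycleBundle K c hc
  have hcov : IsCoveringMap Z.proj := 
    IsCoveringMap.mk _ _ (fun p => Z.localTrivAt p) (fun p => Z.mem_localTrivAt_baseSet p)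
  obtain ⟨f, hf⟩ := hcov.exists_section (fun p => ⟨⟨p, (1 : A)⟩, rfl⟩)
  let val : V → Realization K → A := fun a p => (Z.localTriv a (f p)).2
  have hval : ∀ a, ContinuousOn (val a) (star a) := by
    intro a
    refine continuous_snd.comp_continuousOn
      ((Z.localTriv a).continuousOn_toFun.comp f.continuous.continuousOn ?_)
    intro p hp
    rw [(Z.localTriv a).mem_source, hf p]
    exact hp
  -- over the intersection of two stars, the values of the section differ by the cocycle
  have hmid : ∀ a b p, p ∈ star a → p ∈ star b → val a p * c a b = val b p := by
    intro a b p ha hb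
    have h := Z.coordChange_comp (Z.indexAt (f p).1) a b (f p).1
      ⟨⟨Z.mem_baseSet_at _, by rw [show (f p).1 = p from hf p]; exact ha⟩,
        by rw [show (f p).1 = p from hf p]; exact hb⟩ (f p).2
    exact h
  -- the vertex `a` is the same point in all faces that contain it
  have hpt : ∀ a : V, ∃ x : A, ∀ (s : K.faces) (h : a ∈ s.1),
      val a (simplexMap K s (stdSimplex.vertex (S := ℝ) ⟨a, h⟩)) = x := by
    intro a
    by_cases h : ∃ s : K.faces, a ∈ s.1
    · obtain ⟨s, hs⟩ := h
      refine ⟨val a (simplexMap K s (stdSimplex.vertex (S := ℝ) ⟨a, hs⟩)),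
        fun t ht => congrArg (val a) ?_⟩
      ext b
      simp only [simplexMap_weight, stdSimplex.vertex, Pi.single_apply, Subtype.mk.injEq]
      split_ifs <;> simp_all
    · exact ⟨1, fun s hs => absurd ⟨s, hs⟩ h⟩
  choose g hg using hpt
  refine ⟨g, ?_⟩
  rintro a b ⟨s, hs, ha, hb⟩
  have : Nonempty s := ⟨⟨a, ha⟩⟩
  -- the barycentre of a common face lies in the stars of both vertices
  let q : stdSimplex ℝ s := stdSimplex.barycenter
  have hq : ∀ x : s, 0 < q.1 x := fun x => by
    rw [stdSimplex.barycenter_apply]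
    positivity
  have key : ∀ x : s, val x (simplexMap K ⟨s, hs⟩ q) = g x := by
    intro x
    obtain ⟨S, hS, hSx, h1, h2⟩ := isPreconnected_segment_star ⟨s, hs⟩ q x (hq x)
    rw [← hg x ⟨s, hs⟩ x.2]
    exact hS.constant ((hval x).mono hSx) h1 h2
  have hstar : ∀ x : s, simplexMap K ⟨s, hs⟩ q ∈ star (x : V) := by
    intro x
    obtain ⟨S, hS, hSx, h1, h2⟩ := isPreconnected_segment_star ⟨s, hs⟩ q x (hq x)
    exact hSx h1
  rw [← key ⟨a, ha⟩, ← key ⟨b, hb⟩]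
  exact hmid a b _ (hstar ⟨a, ha⟩) (hstar ⟨b, hb⟩)

end GFP

/-! ### Generators and relations from an action -/

namespace GFP
open Set

universe v
variable {V : Type v} {K : PreAbstractSimplicialComplex V}

/-- Cocycles can be pulled back along any map to the vertices: if `π i` are vertices of a complex
with contractible realization, then a cocycle on the indices `i`, defined along adjacency of the
vertices `π i`, is a coboundary. -/
theorem exists_coboundary_of_map [ContractibleSpace (Realization K)] {A I : Type*} [Group A]
    (π : I → V) (hπ : ∀ a, Adj K a a → ∃ i, π i = a) (c : I → I → A)
    (hc : ∀ s ∈ K.faces, ∀ i j k, π i ∈ s → π j ∈ s → π k ∈ s → c i j * c j k = c i k) :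
    ∃ f : I → A, ∀ i j, Adj K (π i) (π j) → f i * c i j = f j := by
  classical
  rcases isEmpty_or_nonempty I with hI | hI
  · exact ⟨fun _ => 1, fun i => hI.elim i⟩
  choose! τ hτ using hπ
  have hadj : ∀ s ∈ K.faces, ∀ a ∈ s, π (τ a) = a := fun s hs a ha => hτ a ⟨s, hs, ha, ha⟩
  obtain ⟨f, hf⟩ := exists_coboundary (K := K) (fun a b => c (τ a) (τ b))
    (fun s hs a ha b hb d hd => hc s hs _ _ _ (by rwa [hadj s hs a ha])
      (by rwa [hadj s hs b hb]) (by rwa [hadj s hs d hd]))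
  refine ⟨fun i => f (π i) * c (τ (π i)) i, ?_⟩
  rintro i j ⟨s, hs, hi, hj⟩
  have hi' : π (τ (π i)) ∈ s := by rwa [hadj s hs _ hi]
  have hj' : π (τ (π j)) ∈ s := by rwa [hadj s hs _ hj]
  beta_reduce
  rw [mul_assoc, hc s hs _ _ _ hi' hi hj, ← hf _ _ ⟨s, hs, hi, hj⟩, mul_assoc,
    hc s hs _ _ _ hi' hj' hj]

/-- Macbeath's presentation. Suppose that `Γ` acts on a complex `K` with contractible realization,
and that `T` is a connected set of vertices with `Γ T = K⁰`. Then `Γ` is generated by the elements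
`g` for which `T` and `g T` contain adjacent vertices, and the valid products of two generators
form a complete set of relations. The generators may be listed with repetitions. -/
theorem presentation_of_connected [ContractibleSpace (Realization K)] {G : Type*} [Group G]
    [MulAction G V] (Γ : Subgroup G) (hadj : ∀ g ∈ Γ, ∀ a b, Adj K a b → Adj K (g • a) (g • b))
    (T : Set V) {t₀ : V} (ht₀ : t₀ ∈ T) (hT : ∀ a ∈ T, Adj K a a)
    (hcov : ∀ a, Adj K a a → ∃ g ∈ Γ, ∃ t ∈ T, g • t = a)
    (hconn : ∀ S : Set V, t₀ ∈ S → (∀ a ∈ T, ∀ b ∈ T, Adj K a b → a ∈ S → b ∈ S) → T ⊆ S)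
    {n : ℕ} (s : Fin n → G) (R : Set (FreeGroup (Fin n)))
    (hs : ∀ i, s i ∈ Γ ∧ ∃ a ∈ T, ∃ b ∈ T, Adj K a (s i • b))
    (hs' : ∀ g ∈ Γ, ∀ a ∈ T, ∀ b ∈ T, Adj K a (g • b) → ∃ i, s i = g)
    (hR : ∀ r ∈ R, FreeGroup.lift s r = 1)
    (hR' : ∀ i j k, s i * s j = s k →
      FreeGroup.of i * FreeGroup.of j * (FreeGroup.of k)⁻¹ ∈ R) :
    (FreeGroup.lift s).range = Γ ∧ (FreeGroup.lift s).ker = Subgroup.normalClosure R := by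
  classical
  let P := FreeGroup (Fin n) ⧸ Subgroup.normalClosure R
  let mk : FreeGroup (Fin n) →* P := QuotientGroup.mk' _
  have hRker : Subgroup.normalClosure R ≤ (FreeGroup.lift s).ker :=
    Subgroup.normalClosure_le_normal hR
  let φ : P →* G := QuotientGroup.lift _ (FreeGroup.lift s) hRker
  have hφ : ∀ w, φ (mk w) = FreeGroup.lift s w := fun w => rfl
  let x : Fin n → P := fun i => mk (FreeGroup.of i)
  have hφx : ∀ i, φ (x i) = s i := fun i => by rw [hφ, FreeGroup.lift_apply_of]
  have hmul : ∀ i j k, s i * s j = s k → x i * x j = x k := by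
    intro i j k h
    have : mk (FreeGroup.of i * FreeGroup.of j * (FreeGroup.of k)⁻¹) = 1 :=
      (QuotientGroup.eq_one_iff _).2 (Subgroup.subset_normalClosure (hR' i j k h))
    rw [map_mul, map_mul, map_inv, mul_inv_eq_one] at this
    exact this
  obtain ⟨e, he⟩ := hs' 1 Γ.one_mem t₀ ht₀ t₀ ht₀ (by rw [one_smul]; exact hT t₀ ht₀)
  have hxe : x e = 1 := by
    have := hmul e e e (by rw [he, one_mul])
    rwa [mul_eq_left] at this
  have hx : ∀ i j, s i = s j → x i = x j := by
    intro i j h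
    rw [← hmul i e j (by rw [he, mul_one, h]), hxe, mul_one]
  -- `y g` is the class of any generator that is equal to `g`
  let y : G → P := fun g => if h : ∃ i, s i = g then x h.choose else 1
  have hy : ∀ i, y (s i) = x i := by
    intro i
    have h : ∃ j, s j = s i := ⟨i, rfl⟩
    simp only [y, dif_pos h]
    exact hx _ _ h.choose_spec
  have hy1 : y 1 = 1 := by rw [← he, hy, hxe]
  -- Working with the pairs `(g, t)` instead of the vertices `g t` makes the cocycle invariant.
  let I := Γ × T
  let π : I → V := fun i => (i.1 : G) • (i.2 : V)
  have hadj_iff : ∀ i j : I, Adj K (π i) (π j) →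
      Adj K (i.2 : V) (((i.1 : G)⁻¹ * j.1) • (j.2 : V)) := by
    intro i j h
    have := hadj _ (Γ.inv_mem i.1.2) _ _ h
    simpa [π, mul_smul] using this
  have hex : ∀ i j : I, Adj K (π i) (π j) → ∃ k, s k = (i.1 : G)⁻¹ * j.1 := fun i j h =>
    hs' _ (Γ.mul_mem (Γ.inv_mem i.1.2) j.1.2) _ i.2.2 _ j.2.2 (hadj_iff i j h)
  obtain ⟨F, hF⟩ := exists_coboundary_of_map (K := K) π
    (fun a ha => by
      obtain ⟨g, hg, t, ht, h⟩ := hcov a ha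
      exact ⟨(⟨g, hg⟩, ⟨t, ht⟩), h⟩)
    (fun i j => y ((i.1 : G)⁻¹ * j.1)) (by
      intro σ hσ i j k hi hj hk
      obtain ⟨a, ha⟩ := hex i j ⟨σ, hσ, hi, hj⟩
      obtain ⟨b, hb⟩ := hex j k ⟨σ, hσ, hj, hk⟩
      obtain ⟨c, hc⟩ := hex i k ⟨σ, hσ, hi, hk⟩
      rw [← ha, ← hb, ← hc, hy, hy, hy]
      refine hmul a b c ?_
      rw [ha, hb, hc]
      group)
  have hind : ∀ p : I → Prop, (∀ i j, Adj K (π i) (π j) → p i → p j) → ∀ i j, p i → p j := by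
    intro p hp i j hi
    have hvert : ∀ i : I, Adj K (π i) (π i) := fun i => hadj _ i.1.2 _ _ (hT _ i.2.2)
    refine mem_of_adj_closed (K := K) {a | ∀ k, π k = a → p k} (a := π i) (b := π j) ?_
      (fun k hk => hp i k (by rw [hk]; exact hvert i) hi) (hvert i) (hvert j) j rfl
    intro a b hab ha k hk
    obtain ⟨g, hg, t, ht, h⟩ := hcov a (by obtain ⟨σ, hσ, h, -⟩ := hab; exact ⟨σ, hσ, h, h⟩)
    refine hp (⟨g, hg⟩, ⟨t, ht⟩) k ?_ (ha _ h)
    rw [hk, show π (⟨g, hg⟩, ⟨t, ht⟩) = a from h]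
    exact hab
  let i₀ : I := (1, ⟨t₀, ht₀⟩)
  -- normalize the potential at the base index
  let F₀ : I → P := fun i => (F i₀)⁻¹ * F i
  have hF₀ : ∀ i j, Adj K (π i) (π j) → F₀ i * y ((i.1 : G)⁻¹ * j.1) = F₀ j := by
    intro i j h
    simp only [F₀]
    rw [mul_assoc, hF i j h]
  have hF₀i : F₀ i₀ = 1 := inv_mul_cancel _
  have hF1 : ∀ t : T, F₀ (1, t) = 1 := by
    have := hconn {a | ∀ h : a ∈ T, F₀ (1, ⟨a, h⟩) = 1} (fun _ => hF₀i) ?_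
    · exact fun t => this t.2 t.2
    · intro a ha b hb hab haS hb'
      rw [← hF₀ (1, ⟨a, ha⟩) (1, ⟨b, hb'⟩) (by simpa [π] using hab), haS ha]
      simpa using hy1
  have hφF : ∀ i : I, φ (F₀ i) = i.1 := by
    refine fun i => hind (fun i => φ (F₀ i) = i.1) ?_ i₀ i ?_
    · intro i j h hi
      obtain ⟨k, hk⟩ := hex i j h
      rw [← hF₀ i j h, ← hk, hy, map_mul, hφx, hi, hk, mul_inv_cancel_left]
    · rw [hF₀i, map_one]
      rfl
  -- Both sides are potentials of the same cocycle, by its invariance under `g`.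
  have hmulF : ∀ (g : Γ) (i : I), F₀ (g * i.1, i.2) = F₀ (g, i₀.2) * F₀ i := by
    refine fun g i => hind (fun i => F₀ (g * i.1, i.2) = F₀ (g, i₀.2) * F₀ i) ?_ i₀ i ?_
    · intro i j h hi
      have h1 := hF₀ i j h
      have h2 := hF₀ (g * i.1, i.2) (g * j.1, j.2) (by
        have := hadj g g.2 _ _ h
        simpa [π, mul_smul] using this)
      rw [← h1, ← h2, hi]
      simp only [Subgroup.coe_mul, mul_inv_rev, mul_assoc, inv_mul_cancel_left]
    · rw [hF₀i, mul_one]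
      simp [i₀]
  -- `ψ` is a left inverse of `φ`
  let ψ : Γ →* P := MonoidHom.mk' (fun g => F₀ (g, i₀.2)) fun g h => hmulF g (h, i₀.2)
  have hψ : ∀ i, ψ ⟨s i, (hs i).1⟩ = x i := by
    intro i
    obtain ⟨hi, a, ha, b, hb, hab⟩ := hs i
    have h1 := hF₀ (1, ⟨a, ha⟩) (⟨s i, hi⟩, ⟨b, hb⟩) (by simpa [π] using hab)
    rw [hF1, one_mul] at h1
    simp only [Subgroup.coe_one, inv_one, one_mul, hy] at h1
    have h2 := hmulF ⟨s i, hi⟩ (1, ⟨b, hb⟩)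
    rw [hF1] at h2
    simp only [mul_one] at h2
    exact h2.symm.trans h1.symm
  have hmem : ∀ w, FreeGroup.lift s w ∈ Γ := by
    have : (FreeGroup.lift s).range ≤ Γ := by
      rw [FreeGroup.range_lift_eq_closure, Subgroup.closure_le]
      rintro _ ⟨i, rfl⟩
      exact (hs i).1
    exact fun w => this ⟨w, rfl⟩
  have hψmk : ∀ w, ψ ⟨FreeGroup.lift s w, hmem w⟩ = mk w := by
    have : ψ.comp ((FreeGroup.lift s).codRestrict Γ hmem) = mk := by
      ext i
      have := hψ i
      simpa [x] using this
    exact fun w => DFunLike.congr_fun this w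
  refine ⟨le_antisymm ?_ ?_, le_antisymm ?_ hRker⟩
  · rintro _ ⟨w, rfl⟩
    exact hmem w
  · intro g hg
    obtain ⟨w, hw⟩ := QuotientGroup.mk'_surjective _ (F₀ (⟨g, hg⟩, i₀.2))
    refine ⟨w, ?_⟩
    rw [← hφ, show mk w = _ from hw, hφF]
  · intro w hw
    rw [← QuotientGroup.eq_one_iff]
    have h1 := hψmk w
    have h2 : (⟨FreeGroup.lift s w, hmem w⟩ : Γ) = 1 := Subtype.ext hw
    rw [h2, map_one] at h1
    exact h1.symm

end GFP

/-! ### The orbit problem -/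

-- The tactic then proves that functions built from tuples and projections are computable.
attribute [fun_prop] Computable Computable.const Computable.comp Computable.pair Computable.fst
  Computable.snd

@[fun_prop]
theorem Computable.id_fun {α : Type*} [Primcodable α] : Computable fun a : α => a := Computable.id

namespace GFP
open Set

universe u v w

theorem mem_faceImage {G : Type u} {V : Type v} [Group G] [MulAction G V] {g : G} {s : Finset V}
    {a : V} : a ∈ faceImage g s ↔ ∃ b ∈ s, g • b = a := by
  simp only [faceImage, Finset.mem_map]
  rfl

theorem smul_mem_faceImage {G : Type u} {V : Type v} [Group G] [MulAction G V] {g : G}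
    {s : Finset V} {a : V} : g • a ∈ faceImage g s ↔ a ∈ s := by
  simp [mem_faceImage]

attribute [instance] PresentationFamily.action

namespace PresentationFamily

variable {G : Type u} {X : Type w} [Group G] [MulAction G X] {cG : Coding G} {cX : Coding X}
  (P : PresentationFamily.{u, v, w} cG cX)

theorem faceImage_mem_sub {x : X} {g : G} (hg : g ∈ MulAction.stabilizer G x) {s : Finset P.V}
    (hs : s ∈ (P.sub x).faces) : faceImage g s ∈ (P.sub x).faces := by
  have := P.sub_smul g x
  rw [MulAction.mem_stabilizer_iff.1 hg] at this
  rw [this]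
  exact ⟨s, hs, rfl⟩

theorem adj_smul {x : X} {g : G} (hg : g ∈ MulAction.stabilizer G x) {a b : P.V}
    (h : Adj (P.sub x) a b) : Adj (P.sub x) (g • a) (g • b) := by
  obtain ⟨s, hs, ha, hb⟩ := h
  exact ⟨_, P.faceImage_mem_sub hg hs, smul_mem_faceImage.2 ha, smul_mem_faceImage.2 hb⟩

theorem exists_face_of_mem_domain {x : cX.Code} {l : List P.cV.Code} (hl : l ∈ P.domain x) :
    ∃ s ∈ (P.dom x).faces, ∀ a, a ∈ s ↔ ∃ c ∈ l, P.cV.elt c = a := by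
  classical
  have : ∀ a, a ∈ (l.map P.cV.elt).toFinset ↔ ∃ c ∈ l, P.cV.elt c = a := by simp
  exact ⟨_, (P.dom_spec x _).2 ⟨l, hl, this⟩, this⟩

theorem adj_iff (x : cX.Code) (a b : P.V) :
    Adj (P.sub (cX.elt x)) a b ↔ ∃ g ∈ MulAction.stabilizer G (cX.elt x), ∃ l ∈ P.domain x,
      ∃ c ∈ l, ∃ d ∈ l, g • P.cV.elt c = a ∧ g • P.cV.elt d = b := by
  constructor
  · rintro ⟨s, hs, ha, hb⟩
    obtain ⟨g, hg, t, ht, rfl⟩ := (P.dom_covers x s).1 hs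
    obtain ⟨l, hl, hlt⟩ := (P.dom_spec x t).1 ht
    obtain ⟨a', ha', rfl⟩ := mem_faceImage.1 ha
    obtain ⟨b', hb', rfl⟩ := mem_faceImage.1 hb
    obtain ⟨c, hc, rfl⟩ := (hlt _).1 ha'
    obtain ⟨d, hd, rfl⟩ := (hlt _).1 hb'
    exact ⟨g, hg, l, hl, c, hc, d, hd, rfl, rfl⟩
  · rintro ⟨g, hg, l, hl, c, hc, d, hd, rfl, rfl⟩
    obtain ⟨s, hs, hsl⟩ := P.exists_face_of_mem_domain hl
    exact ⟨faceImage g s, (P.dom_covers x _).2 ⟨g, hg, s, hs, rfl⟩,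
      smul_mem_faceImage.2 ((hsl _).2 ⟨c, hc, rfl⟩), smul_mem_faceImage.2 ((hsl _).2 ⟨d, hd, rfl⟩)⟩

/-- The list `D_x` contains a vertex, because `L_x` is contractible and therefore nonempty. -/
theorem exists_mem_domain (x : cX.Code) : ∃ l ∈ P.domain x, ∃ c, c ∈ l := by
  have := P.sub_contractible (cX.elt x)
  obtain ⟨p⟩ : Nonempty (Realization (P.sub (cX.elt x))) := inferInstance
  obtain ⟨a, ha⟩ := p.support_nonempty
  obtain ⟨-, -, l, hl, c, hc, -⟩ := (P.adj_iff x a a).1 ⟨_, p.support_mem, ha, ha⟩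
  exact ⟨l, hl, c, hc⟩

theorem adj_self_of_mem_domain {x : cX.Code} {l : List P.cV.Code} (hl : l ∈ P.domain x)
    {c : P.cV.Code} (hc : c ∈ l) : Adj (P.sub (cX.elt x)) (P.cV.elt c) (P.cV.elt c) :=
  (P.adj_iff x _ _).2 ⟨1, one_mem _, l, hl, c, hc, c, hc, one_smul _ _, one_smul _ _⟩

section

variable {α : Type*} [Primcodable α]

include P in
theorem computablePred_smul {f : α → cG.Code} {p q : α → cX.Code} (hf : Computable f)
    (hp : Computable p) (hq : Computable q) :
    ComputablePred fun t => cG.elt (f t) • cX.elt (p t) = cX.elt (q t) :=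
  P.smul_decidable.comp (hf.pair (hp.pair hq))

include P in
theorem computablePred_mul {f g h : α → cG.Code} (hf : Computable f)
    (hg : Computable g) (hh : Computable h) :
    ComputablePred fun t => cG.elt (f t) * cG.elt (g t) = cG.elt (h t) :=
  P.mul_decidable.comp (hf.pair (hg.pair hh))

theorem computable_transporter {f g : α → P.cV.Code}
    (hf : Computable f) (hg : Computable g) : Computable fun a => P.transporter (f a, g a) :=
  P.transporter_computable.comp (hf.pair hg)

end

/-- If `g x = y`, then `g` may be corrected by an element of `G_y` so that it maps a given vertex of
`D_x` to a vertex of `D_y`. -/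
theorem exists_smul_eq_iff (x y : cX.Code) :
    (∃ g : G, g • cX.elt x = cX.elt y) ↔ ∃ l ∈ P.domain x, ∃ a ∈ l, ∃ l' ∈ P.domain y, ∃ b ∈ l',
      ∃ c ∈ P.transporter (a, b), cG.elt c • cX.elt x = cX.elt y := by
  constructor
  · rintro ⟨g, hg⟩
    obtain ⟨l, hl, a, ha⟩ := P.exists_mem_domain x
    obtain ⟨s, hs, hsa, -⟩ := P.adj_self_of_mem_domain hl ha
    have h1 : faceImage g s ∈ (P.sub (cX.elt y)).faces := by
      rw [← hg, P.sub_smul]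
      exact ⟨s, hs, rfl⟩
    obtain ⟨h, hh, l', hl', b, hb, -, -, hbg, -⟩ :=
      (P.adj_iff y (g • P.cV.elt a) (g • P.cV.elt a)).1 ⟨_, h1,
        smul_mem_faceImage.2 hsa, smul_mem_faceImage.2 hsa⟩
    obtain ⟨c, hc, hcg⟩ := (P.transporter_spec a b (h⁻¹ * g)).1 (by
      rw [mul_smul, ← hbg, inv_smul_smul])
    refine ⟨l, hl, a, ha, l', hl', b, hb, c, hc, ?_⟩
    rw [hcg, mul_smul, hg, inv_smul_eq_iff, MulAction.mem_stabilizer_iff.1 hh]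
  · rintro ⟨-, -, -, -, -, -, -, -, c, -, hc⟩
    exact ⟨_, hc⟩

include P in
theorem computablePred_orbit : ComputablePred fun t : cX.Code × cX.Code =>
    ∃ g : G, g • cX.elt t.1 = cX.elt t.2 := by
  refine ComputablePred.of_eq ?_ fun t => (P.exists_smul_eq_iff t.1 t.2).symm
  have hd := P.domain_computable
  refine ComputablePred.exists_mem_list (by fun_prop) ?_
  refine ComputablePred.exists_mem_list (by fun_prop) ?_
  refine ComputablePred.exists_mem_list (by fun_prop) ?_
  refine ComputablePred.exists_mem_list (by fun_prop) ?_
  refine ComputablePred.exists_mem_list (P.computable_transporter (by fun_prop) (by fun_prop)) ?_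
  exact P.computablePred_smul (by fun_prop) (by fun_prop) (by fun_prop)

include P in
/-- Unbounded search finds a transporting element once its existence has been decided. -/
theorem exists_orbit_algorithm : ∃ orbit : cX.Code × cX.Code → Option cG.Code, Computable orbit ∧
    ∀ x y : cX.Code, ((orbit (x, y)).isSome ↔ ∃ g : G, g • cX.elt x = cX.elt y) ∧
      ∀ c ∈ orbit (x, y), cG.elt c • cX.elt x = cX.elt y := by
  have h := exists_computable_choice
    (R := fun (t : cX.Code × cX.Code) (o : Option cG.Code) =>
      ((∃ g : G, g • cX.elt t.1 = cX.elt t.2) → ∃ c ∈ o, cG.elt c • cX.elt t.1 = cX.elt t.2) ∧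
        ∀ c ∈ o, cG.elt c • cX.elt t.1 = cX.elt t.2) ?_ ?_
  · obtain ⟨f, hf, hf'⟩ := h
    refine ⟨f, hf, fun x y => ⟨⟨fun h => ?_, fun h => ?_⟩, (hf' (x, y)).2⟩⟩
    · obtain ⟨c, hc⟩ := Option.isSome_iff_exists.1 h
      exact ⟨_, (hf' (x, y)).2 c hc⟩
    · obtain ⟨c, hc, -⟩ := (hf' (x, y)).1 h
      exact Option.isSome_iff_exists.2 ⟨c, hc⟩
  · refine (ComputablePred.imp (P.computablePred_orbit.comp Computable.fst) ?_).conj ?_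
    · exact ComputablePred.exists_mem_option (by fun_prop)
        (P.computablePred_smul (by fun_prop) (by fun_prop) (by fun_prop))
    · exact ComputablePred.forall_mem_option (by fun_prop)
        (P.computablePred_smul (by fun_prop) (by fun_prop) (by fun_prop))
  · rintro ⟨x, y⟩
    by_cases hg : ∃ g : G, g • cX.elt x = cX.elt y
    · obtain ⟨g, hg'⟩ := hg
      obtain ⟨c, rfl⟩ := cG.surjective_elt g
      exact ⟨some c, fun _ => ⟨c, rfl, hg'⟩, fun d hd => by
        obtain rfl := Option.some.inj hd; exact hg'⟩
    · exact ⟨none, fun h => absurd h hg, fun d hd => by simp at hd⟩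

/-! ### The presentation of a stabilizer -/

/-- The element `g` named `c` lies in `G_x`, and `a` and `g b` are adjacent in `L_x`; see
`adjVia_iff`. This is written as `g = h k` with `h` and `k` in `G_x`, where `h⁻¹ a` and `k b` belong
to a common simplex of `D_x`, so that all quantifiers range over computable lists. -/
def AdjVia (x : cX.Code) (a b : P.cV.Code) (c : cG.Code) : Prop :=
  ∃ l ∈ P.domain x, ∃ a' ∈ l, ∃ b' ∈ l, ∃ h ∈ P.transporter (a', a), ∃ k ∈ P.transporter (b, b'),
    cG.elt h • cX.elt x = cX.elt x ∧ cG.elt k • cX.elt x = cX.elt x ∧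
      cG.elt h * cG.elt k = cG.elt c

theorem adjVia_iff (x : cX.Code) (a b : P.cV.Code) (c : cG.Code) :
    P.AdjVia x a b c ↔ cG.elt c ∈ MulAction.stabilizer G (cX.elt x) ∧
      Adj (P.sub (cX.elt x)) (P.cV.elt a) (cG.elt c • P.cV.elt b) := by
  constructor
  · rintro ⟨l, hl, a', ha', b', hb', h, hh, k, hk, hx, kx, hc⟩
    have h1 := (P.transporter_spec a' a _).2 ⟨h, hh, rfl⟩
    have h2 := (P.transporter_spec b b' _).2 ⟨k, hk, rfl⟩
    refine ⟨hc ▸ mul_mem hx kx, (P.adj_iff x _ _).2 ⟨_, hx, l, hl, a', ha', b', hb', h1, ?_⟩⟩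
    rw [← hc, mul_smul, h2]
  · rintro ⟨hc, h⟩
    obtain ⟨g, hg, l, hl, a', ha', b', hb', h1, h2⟩ := (P.adj_iff x _ _).1 h
    obtain ⟨h, hh, rfl⟩ := (P.transporter_spec a' a _).1 h1
    obtain ⟨k, hk, hk'⟩ := (P.transporter_spec b b' ((cG.elt h)⁻¹ * cG.elt c)).1 (by
      rw [mul_smul, ← h2, inv_smul_smul])
    refine ⟨l, hl, a', ha', b', hb', h, hh, k, hk, hg, ?_, ?_⟩
    · rw [hk']
      exact mul_mem (inv_mem hg) hc
    · rw [hk', mul_inv_cancel_left]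

theorem computablePred_adjVia {α : Type*} [Primcodable α] {x : α → cX.Code}
    {a b : α → P.cV.Code} {c : α → cG.Code} (hx : Computable x) (ha : Computable a)
    (hb : Computable b) (hc : Computable c) :
    ComputablePred fun t => P.AdjVia (x t) (a t) (b t) (c t) := by
  have hd := P.domain_computable
  refine ComputablePred.exists_mem_list (by fun_prop) ?_
  refine ComputablePred.exists_mem_list (by fun_prop) ?_
  refine ComputablePred.exists_mem_list (by fun_prop) ?_
  refine ComputablePred.exists_mem_list (P.computable_transporter (by fun_prop) (by fun_prop)) ?_
  refine ComputablePred.exists_mem_list (P.computable_transporter (by fun_prop) (by fun_prop)) ?_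
  refine ComputablePred.conj ?_ (ComputablePred.conj ?_ ?_)
  · exact P.computablePred_smul (by fun_prop) (by fun_prop) (by fun_prop)
  · exact P.computablePred_smul (by fun_prop) (by fun_prop) (by fun_prop)
  · exact P.computablePred_mul (by fun_prop) (by fun_prop) (by fun_prop)

theorem finite_adjVia (x : cX.Code) (W : List P.cV.Code) :
    {g : G | ∃ c, cG.elt c = g ∧ ∃ a ∈ W, ∃ b ∈ W, P.AdjVia x a b c}.Finite := by
  have hl : ∀ {β : Type} (l : List β), {b | b ∈ l}.Finite := fun l => l.finite_toSet
  have : (⋃ a ∈ {a | a ∈ W}, ⋃ b ∈ {b | b ∈ W}, ⋃ l ∈ {l | l ∈ P.domain x}, ⋃ a' ∈ {a' | a' ∈ l},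
      ⋃ b' ∈ {b' | b' ∈ l}, ⋃ h ∈ {h | h ∈ P.transporter (a', a)},
      ⋃ k ∈ {k | k ∈ P.transporter (b, b')}, {cG.elt h * cG.elt k}).Finite :=
    (hl _).biUnion fun _ _ => (hl _).biUnion fun _ _ => (hl _).biUnion fun _ _ =>
      (hl _).biUnion fun _ _ => (hl _).biUnion fun _ _ => (hl _).biUnion fun _ _ =>
        (hl _).biUnion fun _ _ => finite_singleton _
  refine this.subset ?_
  rintro _ ⟨c, rfl, a, ha, b, hb, l, hl, a', ha', b', hb', h, hh, k, hk, -, -, hc⟩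
  simp only [mem_iUnion, mem_ofPred_eq, mem_singleton_iff, exists_prop]
  exact ⟨a, ha, b, hb, l, hl, a', ha', b', hb', h, hh, k, hk, hc.symm⟩

end PresentationFamily
end GFP

namespace GFP
open Set

universe u v w

namespace PresentationFamily

variable {G : Type u} {X : Type w} [Group G] [MulAction G X] {cG : Coding G} {cX : Coding X}
  (P : PresentationFamily.{u, v, w} cG cX)

/-- A chain of vertices of `L_x`, with respect to the name `e` of the identity: each of its terms
except the first is adjacent to an earlier one. -/
def IsChain (e : cG.Code) (x : cX.Code) (W : List P.cV.Code) : Prop :=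
  (∀ a ∈ W, P.AdjVia x a a e) ∧
    ∀ j < W.length, j = 0 ∨ ∃ i < j, ∃ a ∈ W[i]?, ∃ b ∈ W[j]?, P.AdjVia x a b e

/-- The word `sᵢ sⱼ sₖ⁻¹`. -/
def mulRelator (i j k : ℕ) : List (ℕ × Bool) := [(i, true), (j, true), (k, false)]

/-- The list `R` consists of the words `sᵢ sⱼ sₖ⁻¹` that are trivial in `G`. -/
def IsMulTable (cG : Coding G) (S : List cG.Code) (R : List (List (ℕ × Bool))) : Prop :=
  (∀ i < S.length, ∀ j < S.length, ∀ k < S.length, ∀ a ∈ S[i]?, ∀ b ∈ S[j]?, ∀ c ∈ S[k]?,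
    cG.elt a * cG.elt b = cG.elt c → ∃ r ∈ R, r = mulRelator i j k) ∧
  ∀ r ∈ R, ∃ i < S.length, ∃ j < S.length, ∃ k < S.length, r = mulRelator i j k ∧
    ∃ a ∈ S[i]?, ∃ b ∈ S[j]?, ∃ c ∈ S[k]?, cG.elt a * cG.elt b = cG.elt c

/-- The decidable conditions under which `S` and `R` form a Macbeath presentation of `G_x`, for the
connected set `W` of vertices of `L_x`. -/
def IsCertificate (e : cG.Code) (x : cX.Code)
    (t : List P.cV.Code × List cG.Code × List (List (ℕ × Bool))) : Prop :=
  P.IsChain e x t.1 ∧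
  (∀ l ∈ P.domain x, ∀ a ∈ l, ∃ b ∈ t.1, ∃ c ∈ P.transporter (b, a),
    cG.elt c • cX.elt x = cX.elt x) ∧
  (∀ c ∈ t.2.1, ∃ a ∈ t.1, ∃ b ∈ t.1, P.AdjVia x a b c) ∧
  (∀ a ∈ t.1, ∀ b ∈ t.1, ∀ l ∈ P.domain x, ∀ a' ∈ l, ∀ b' ∈ l,
    ∀ h ∈ P.transporter (a', a), ∀ k ∈ P.transporter (b, b'),
      cG.elt h • cX.elt x = cX.elt x → cG.elt k • cX.elt x = cX.elt x →
        ∃ c ∈ t.2.1, cG.elt h * cG.elt k = cG.elt c) ∧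
  IsMulTable cG t.2.1 t.2.2

theorem computable_mulRelator {α : Type*} [Primcodable α] {i j k : α → ℕ} (hi : Computable i)
    (hj : Computable j) (hk : Computable k) :
    Computable fun t => mulRelator (i t) (j t) (k t) := by
  have h1 : Computable fun t => [(k t, false)] :=
    Computable.list_cons.comp (by fun_prop) (by fun_prop)
  have h2 : Computable fun t => [(j t, true), (k t, false)] :=
    Computable.list_cons.comp (by fun_prop) h1
  exact Computable.list_cons.comp (by fun_prop) h2

theorem computable_getElem? {α β : Type*} [Primcodable α] [Primcodable β] {l : α → List β}
    {i : α → ℕ} (hl : Computable l) (hi : Computable i) : Computable fun t => (l t)[i t]? :=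
  Computable.list_getElem?.comp hl hi

theorem computable_length {α β : Type*} [Primcodable α] [Primcodable β] {l : α → List β}
    (hl : Computable l) : Computable fun t => (l t).length :=
  Computable.list_length.comp hl

include P in
theorem computablePred_isMulTable {α : Type*} [Primcodable α] {S : α → List cG.Code}
    {R : α → List (List (ℕ × Bool))} (hS : Computable S) (hR : Computable R) :
    ComputablePred fun t => IsMulTable cG (S t) (R t) := by
  refine ComputablePred.conj ?_ ?_
  · refine ComputablePred.forall_lt (computable_length hS) ?_
    refine ComputablePred.forall_lt (computable_length (by fun_prop)) ?_
    refine ComputablePred.forall_lt (computable_length (by fun_prop)) ?_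
    refine ComputablePred.forall_mem_option (computable_getElem? (by fun_prop) (by fun_prop)) ?_
    refine ComputablePred.forall_mem_option (computable_getElem? (by fun_prop) (by fun_prop)) ?_
    refine ComputablePred.forall_mem_option (computable_getElem? (by fun_prop) (by fun_prop)) ?_
    refine ComputablePred.imp ?_ ?_
    · exact P.computablePred_mul (by fun_prop) (by fun_prop) (by fun_prop)
    · refine ComputablePred.exists_mem_list (by fun_prop) ?_
      exact ComputablePred.eq (by fun_prop)
        (computable_mulRelator (by fun_prop) (by fun_prop) (by fun_prop))
  · refine ComputablePred.forall_mem_list hR ?_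
    refine ComputablePred.exists_lt (computable_length (by fun_prop)) ?_
    refine ComputablePred.exists_lt (computable_length (by fun_prop)) ?_
    refine ComputablePred.exists_lt (computable_length (by fun_prop)) ?_
    refine ComputablePred.conj ?_ ?_
    · exact ComputablePred.eq (by fun_prop)
        (computable_mulRelator (by fun_prop) (by fun_prop) (by fun_prop))
    refine ComputablePred.exists_mem_option (computable_getElem? (by fun_prop) (by fun_prop)) ?_
    refine ComputablePred.exists_mem_option (computable_getElem? (by fun_prop) (by fun_prop)) ?_
    refine ComputablePred.exists_mem_option (computable_getElem? (by fun_prop) (by fun_prop)) ?_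
    exact P.computablePred_mul (by fun_prop) (by fun_prop) (by fun_prop)

theorem computablePred_isChain (e : cG.Code) {α : Type*} [Primcodable α] {x : α → cX.Code}
    {W : α → List P.cV.Code} (hx : Computable x) (hW : Computable W) :
    ComputablePred fun t => P.IsChain e (x t) (W t) := by
  refine ComputablePred.conj ?_ ?_
  · refine ComputablePred.forall_mem_list hW ?_
    exact P.computablePred_adjVia (by fun_prop) (by fun_prop) (by fun_prop) (by fun_prop)
  · refine ComputablePred.forall_lt (computable_length hW) ?_
    refine ComputablePred.disj (ComputablePred.eq (by fun_prop) (by fun_prop)) ?_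
    refine ComputablePred.exists_lt (by fun_prop) ?_
    refine ComputablePred.exists_mem_option (computable_getElem? (by fun_prop) (by fun_prop)) ?_
    refine ComputablePred.exists_mem_option (computable_getElem? (by fun_prop) (by fun_prop)) ?_
    exact P.computablePred_adjVia (by fun_prop) (by fun_prop) (by fun_prop) (by fun_prop)

theorem computablePred_isCertificate (e : cG.Code) :
    ComputablePred fun t : cX.Code × List P.cV.Code × List cG.Code × List (List (ℕ × Bool)) =>
      P.IsCertificate e t.1 t.2 := by
  have hd := P.domain_computable
  refine ComputablePred.conj (P.computablePred_isChain e (by fun_prop) (by fun_prop)) ?_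
  refine ComputablePred.conj ?_ (ComputablePred.conj ?_ (ComputablePred.conj ?_ ?_))
  · refine ComputablePred.forall_mem_list (by fun_prop) ?_
    refine ComputablePred.forall_mem_list (by fun_prop) ?_
    refine ComputablePred.exists_mem_list (by fun_prop) ?_
    refine ComputablePred.exists_mem_list (P.computable_transporter (by fun_prop) (by fun_prop)) ?_
    exact P.computablePred_smul (by fun_prop) (by fun_prop) (by fun_prop)
  · refine ComputablePred.forall_mem_list (by fun_prop) ?_
    refine ComputablePred.exists_mem_list (by fun_prop) ?_
    refine ComputablePred.exists_mem_list (by fun_prop) ?_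
    exact P.computablePred_adjVia (by fun_prop) (by fun_prop) (by fun_prop) (by fun_prop)
  · refine ComputablePred.forall_mem_list (by fun_prop) ?_
    refine ComputablePred.forall_mem_list (by fun_prop) ?_
    refine ComputablePred.forall_mem_list (by fun_prop) ?_
    refine ComputablePred.forall_mem_list (by fun_prop) ?_
    refine ComputablePred.forall_mem_list (by fun_prop) ?_
    refine ComputablePred.forall_mem_list (P.computable_transporter (by fun_prop) (by fun_prop)) ?_
    refine ComputablePred.forall_mem_list (P.computable_transporter (by fun_prop) (by fun_prop)) ?_
    refine ComputablePred.imp ?_ (ComputablePred.imp ?_ ?_)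
    · exact P.computablePred_smul (by fun_prop) (by fun_prop) (by fun_prop)
    · exact P.computablePred_smul (by fun_prop) (by fun_prop) (by fun_prop)
    · refine ComputablePred.exists_mem_list (by fun_prop) ?_
      exact P.computablePred_mul (by fun_prop) (by fun_prop) (by fun_prop)
  · exact P.computablePred_isMulTable (by fun_prop) (by fun_prop)

theorem exists_isMulTable (cG : Coding G) (S : List cG.Code) : ∃ R, IsMulTable cG S R := by
  classical
  let n := S.length
  let T : Set (List (ℕ × Bool)) := {r | ∃ i < S.length, ∃ j < S.length, ∃ k < S.length,
    r = mulRelator i j k ∧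
      ∃ a ∈ S[i]?, ∃ b ∈ S[j]?, ∃ c ∈ S[k]?, cG.elt a * cG.elt b = cG.elt c}
  have hT : T.Finite := by
    refine (((finite_Iio n).prod ((finite_Iio n).prod (finite_Iio n))).image
      fun t => mulRelator t.1 t.2.1 t.2.2).subset ?_
    rintro _ ⟨i, hi, j, hj, k, hk, rfl, -⟩
    exact ⟨(i, j, k), ⟨hi, hj, hk⟩, rfl⟩
  refine ⟨hT.toFinset.toList, ?_, ?_⟩
  · intro i hi j hj k hk a ha b hb c hc h
    refine ⟨_, ?_, rfl⟩
    rw [Finset.mem_toList, Set.Finite.mem_toFinset]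
    exact ⟨i, hi, j, hj, k, hk, rfl, a, ha, b, hb, c, hc, h⟩
  · intro r hr
    rw [Finset.mem_toList, Set.Finite.mem_toFinset] at hr
    exact hr

theorem adjVia_one_iff {e : cG.Code} (he : cG.elt e = 1) (x : cX.Code) (a b : P.cV.Code) :
    P.AdjVia x a b e ↔ Adj (P.sub (cX.elt x)) (P.cV.elt a) (P.cV.elt b) := by
  rw [adjVia_iff, he, one_smul]
  exact and_iff_right (one_mem _)

theorem IsChain.concat {e : cG.Code} {x : cX.Code} {W : List P.cV.Code}
    (hW : P.IsChain e x W) {a b : P.cV.Code} (ha : a ∈ W) (hab : P.AdjVia x a b e)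
    (hb : P.AdjVia x b b e) : P.IsChain e x (W ++ [b]) := by
  refine ⟨fun c hc => ?_, fun j hj => ?_⟩
  · rcases List.mem_append.1 hc with hc | hc
    · exact hW.1 c hc
    · rw [List.mem_singleton.1 hc]
      exact hb
  · rw [List.length_append, List.length_singleton] at hj
    rcases Nat.lt_succ_iff_lt_or_eq.1 hj with hj | rfl
    · rcases hW.2 j hj with h | ⟨i, hi, c, hc, d, hd, h⟩
      · exact Or.inl h
      · refine Or.inr ⟨i, hi, c, ?_, d, ?_, h⟩
        · rwa [List.getElem?_append_left (hi.trans hj)]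
        · rwa [List.getElem?_append_left hj]
    · obtain ⟨i, hi, rfl⟩ := List.getElem_of_mem ha
      refine Or.inr ⟨i, hi, _, ?_, b, ?_, hab⟩
      · rw [List.getElem?_append_left hi]
        simp [hi]
      · simp

/-- The vertices of a finite list can be joined within the connected complex `L_x`. -/
theorem exists_isChain {e : cG.Code} (he : cG.elt e = 1) (x : cX.Code) (M : List P.cV.Code)
    (hM : ∀ a ∈ M, P.AdjVia x a a e) : ∃ W, P.IsChain e x W ∧ ∀ a ∈ M, ∃ b ∈ W,
      P.cV.elt b = P.cV.elt a := by
  have := P.sub_contractible (cX.elt x)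
  obtain ⟨l, hl, a₀, ha₀⟩ := P.exists_mem_domain x
  have h₀ := P.adj_self_of_mem_domain hl ha₀
  -- the vertices that occur in chains extending `W` are closed under adjacency
  have hext : ∀ W, P.IsChain e x W → a₀ ∈ W → ∀ a, P.AdjVia x a a e →
      ∃ W', P.IsChain e x W' ∧ W ⊆ W' ∧ ∃ b ∈ W', P.cV.elt b = P.cV.elt a := by
    intro W hW haW a ha
    refine mem_of_adj_closed (K := P.sub (cX.elt x))
      {v | ∃ W', P.IsChain e x W' ∧ W ⊆ W' ∧ ∃ b ∈ W', P.cV.elt b = v} ?_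
      ⟨W, hW, List.Subset.refl W, a₀, haW, rfl⟩ h₀ ((P.adjVia_one_iff he x a a).1 ha)
    rintro _ v huv ⟨W', hW', hWW', b, hb, rfl⟩
    obtain ⟨c, rfl⟩ := P.cV.surjective_elt v
    refine ⟨W' ++ [c], hW'.concat P hb ((P.adjVia_one_iff he x _ _).2 huv)
      ((P.adjVia_one_iff he x _ _).2 ?_), List.subset_append_of_subset_left _ hWW', c, by simp, rfl⟩
    obtain ⟨s, hs, -, h⟩ := huv
    exact ⟨s, hs, h, h⟩
  suffices ∃ W, P.IsChain e x W ∧ a₀ ∈ W ∧ ∀ a ∈ M, ∃ b ∈ W, P.cV.elt b = P.cV.elt a by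
    obtain ⟨W, h1, -, h2⟩ := this
    exact ⟨W, h1, h2⟩
  induction M with
  | nil =>
    refine ⟨[a₀], ⟨fun a ha => ?_, fun j hj => Or.inl ?_⟩, by simp, by simp⟩
    · rw [List.mem_singleton.1 ha]
      exact (P.adjVia_one_iff he x _ _).2 h₀
    · simpa using hj
  | cons a M ih =>
    obtain ⟨W, hW, haW, hWM⟩ := ih fun b hb => hM b (List.mem_cons_of_mem _ hb)
    obtain ⟨W', hW', hWW', ha⟩ := hext W hW haW a (hM a List.mem_cons_self)
    refine ⟨W', hW', hWW' haW, fun b hb => ?_⟩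
    rcases List.mem_cons.1 hb with rfl | hb
    · exact ha
    · obtain ⟨c, hc, h⟩ := hWM b hb
      exact ⟨c, hWW' hc, h⟩

/-- The search for a certificate terminates. -/
theorem exists_isCertificate {e : cG.Code} (he : cG.elt e = 1) (x : cX.Code) :
    ∃ t, P.IsCertificate e x t := by
  obtain ⟨W, hW, hWM⟩ := P.exists_isChain he x (P.domain x).flatten fun a ha => by
    obtain ⟨l, hl, hal⟩ := List.mem_flatten.1 ha
    exact (P.adjVia_one_iff he x a a).2 (P.adj_self_of_mem_domain hl hal)
  obtain ⟨N, hN⟩ := (P.finite_adjVia x W).exists_finset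
  choose name hname using cG.surjective_elt
  obtain ⟨R, hR⟩ := exists_isMulTable cG (N.toList.map name)
  refine ⟨(W, N.toList.map name, R), hW, ?_, ?_, ?_, hR⟩
  · intro l hl a ha
    obtain ⟨b, hb, hba⟩ := hWM a (List.mem_flatten.2 ⟨l, hl, ha⟩)
    obtain ⟨c, hc, hc1⟩ := (P.transporter_spec b a 1).1 (by rw [one_smul, hba])
    exact ⟨b, hb, c, hc, by rw [hc1, one_smul]⟩
  · intro c hc
    obtain ⟨g, hg, rfl⟩ := List.mem_map.1 hc
    obtain ⟨d, rfl, a, ha, b, hb, h⟩ := (hN g).1 (Finset.mem_toList.1 hg)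
    refine ⟨a, ha, b, hb, ?_⟩
    rw [adjVia_iff] at h ⊢
    rwa [hname]
  · intro a ha b hb l hl a' ha' b' hb' h hh k hk hx kx
    have hmem : cG.elt h * cG.elt k ∈ N := (hN _).2 ⟨name _, hname _, a, ha, b, hb, l, hl, a', ha',
      b', hb', h, hh, k, hk, hx, kx, (hname _).symm⟩
    exact ⟨_, List.mem_map.2 ⟨_, Finset.mem_toList.2 hmem, rfl⟩, (hname _).symm⟩

theorem IsCertificate.isFinitePresentation {e : cG.Code} (he : cG.elt e = 1) {x : cX.Code}
    {t : List P.cV.Code × List cG.Code × List (List (ℕ × Bool))} (ht : P.IsCertificate e x t) :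
    IsFinitePresentation (MulAction.stabilizer G (cX.elt x)) (t.2.1.map cG.elt) t.2.2 := by
  have := P.sub_contractible (cX.elt x)
  obtain ⟨W, S, R⟩ := t
  obtain ⟨hchain, hdom, hS, hS', hR, hR'⟩ := ht
  dsimp only at *
  have hlen : (S.map cG.elt).length = S.length := List.length_map _
  have hget : ∀ i : Fin (S.map cG.elt).length, ∀ c ∈ S[(i : ℕ)]?,
      (S.map cG.elt).get i = cG.elt c := by
    intro i c hc
    have h := i.2.trans_eq hlen
    rw [Option.mem_def, List.getElem?_eq_getElem h, Option.some.injEq] at hc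
    simp [hc]
  have hget' : ∀ i : Fin (S.map cG.elt).length, ∃ c ∈ S, c ∈ S[(i : ℕ)]? := by
    intro i
    have h := i.2.trans_eq hlen
    exact ⟨S[(i : ℕ)], List.getElem_mem h, by simp [h]⟩
  obtain ⟨l, hl, d, hd⟩ := P.exists_mem_domain x
  obtain ⟨w, hw, -⟩ := hdom l hl d hd
  have hpos : 0 < W.length := List.length_pos_of_mem hw
  let T : Set P.V := {a | ∃ c ∈ W, P.cV.elt c = a}
  refine ⟨?_, ?_⟩
  · intro r hr p hp
    obtain ⟨i, hi, j, hj, k, hk, rfl, -⟩ := hR' r hr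
    rw [hlen]
    simp only [mulRelator, List.mem_cons, List.not_mem_nil, or_false] at hp
    rcases hp with rfl | rfl | rfl <;> assumption
  refine presentation_of_connected (K := P.sub (cX.elt x)) (MulAction.stabilizer G (cX.elt x))
    (fun g hg a b h => P.adj_smul hg h) T (t₀ := P.cV.elt W[0]) ⟨_, List.getElem_mem hpos, rfl⟩
    ?_ ?_ ?_ _ _ ?_ ?_ ?_ ?_
  · rintro _ ⟨c, hc, rfl⟩
    exact (P.adjVia_one_iff he x c c).1 (hchain.1 c hc)
  · intro a ha
    obtain ⟨g, hg, l, hl, c, hc, -, -, rfl, -⟩ := (P.adj_iff x a a).1 ha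
    obtain ⟨b, hb, h, hh, hx⟩ := hdom l hl c hc
    refine ⟨g * cG.elt h, mul_mem hg hx, _, ⟨b, hb, rfl⟩, ?_⟩
    rw [mul_smul, (P.transporter_spec b c _).2 ⟨h, hh, rfl⟩]
  · intro A h0 hA
    have : ∀ j (hj : j < W.length), P.cV.elt W[j] ∈ A := by
      intro j
      induction j using Nat.strong_induction_on with
      | _ j ih =>
        intro hj
        rcases hchain.2 j hj with rfl | ⟨i, hi, a, ha, b, hb, hab⟩
        · exact h0
        · have hi' := hi.trans hj
          rw [Option.mem_def, List.getElem?_eq_getElem hi', Option.some.injEq] at ha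
          rw [Option.mem_def, List.getElem?_eq_getElem hj, Option.some.injEq] at hb
          subst ha hb
          exact hA _ ⟨_, List.getElem_mem hi', rfl⟩ _ ⟨_, List.getElem_mem hj, rfl⟩
            ((P.adjVia_one_iff he x _ _).1 hab) (ih i hi hi')
    rintro _ ⟨c, hc, rfl⟩
    obtain ⟨j, hj, rfl⟩ := List.getElem_of_mem hc
    exact this j hj
  · intro i
    obtain ⟨c, hc, hci⟩ := hget' i
    rw [hget i c hci]
    obtain ⟨a, ha, b, hb, h⟩ := hS c hc
    obtain ⟨h1, h2⟩ := (P.adjVia_iff x a b c).1 h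
    exact ⟨h1, _, ⟨a, ha, rfl⟩, _, ⟨b, hb, rfl⟩, h2⟩
  · rintro g hg _ ⟨a, ha, rfl⟩ _ ⟨b, hb, rfl⟩ h
    obtain ⟨c, rfl⟩ := cG.surjective_elt g
    obtain ⟨l, hl, a', ha', b', hb', h, hh, k, hk, hx, kx, hc⟩ := (P.adjVia_iff x a b c).2 ⟨hg, h⟩
    obtain ⟨d, hd, hd'⟩ := hS' a ha b hb l hl a' ha' b' hb' h hh k hk hx kx
    obtain ⟨i, hi, rfl⟩ := List.getElem_of_mem hd
    refine ⟨⟨i, by rwa [hlen]⟩, ?_⟩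
    rw [hget _ S[i] (by simp [hi]), ← hd', hc]
  · rintro _ ⟨l, hl, rfl⟩
    obtain ⟨i, hi, j, hj, k, hk, hijk, a, ha, b, hb, c, hc, habc⟩ := hR' _ hl
    rw [← hlen] at hi hj hk
    have : l = [(⟨i, hi⟩, true), (⟨j, hj⟩, true), (⟨k, hk⟩, false)] := by
      refine List.map_injective_iff.2 ?_ hijk
      rintro ⟨p, p'⟩ ⟨q, q'⟩ h
      simpa [Fin.ext_iff] using h
    subst this
    rw [FreeGroup.lift_mk]
    simp only [List.map_cons, List.map_nil, List.prod_cons, List.prod_nil, cond_true, cond_false]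
    rw [hget ⟨i, hi⟩ a ha, hget ⟨j, hj⟩ b hb, hget ⟨k, hk⟩ c hc, ← habc]
    group
  · intro i j k h
    obtain ⟨a, haS, ha⟩ := hget' i
    obtain ⟨b, hbS, hb⟩ := hget' j
    obtain ⟨c, hcS, hc⟩ := hget' k
    rw [hget i a ha, hget j b hb, hget k c hc] at h
    obtain ⟨r, hr, rfl⟩ := hR i (hlen ▸ i.2) j (hlen ▸ j.2) k (hlen ▸ k.2) a ha b hb c hc h
    exact ⟨[(i, true), (j, true), (k, false)], hr, rfl⟩

include P in
theorem exists_presentation_algorithm :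
    ∃ pres : cX.Code → List cG.Code × List (List (ℕ × Bool)), Computable pres ∧
      ∀ x : cX.Code, IsFinitePresentation (MulAction.stabilizer G (cX.elt x))
        ((pres x).1.map cG.elt) (pres x).2 := by
  obtain ⟨e, he⟩ := cG.surjective_elt 1
  obtain ⟨f, hf, hf'⟩ := exists_computable_choice (P.computablePred_isCertificate e)
    (P.exists_isCertificate he)
  exact ⟨fun x => (f x).2, Computable.snd.comp hf, fun x => (hf' x).isFinitePresentation P he⟩

end PresentationFamily
end GFP

/-! ### Homotopy groups of spaces with a contractible covering -/

namespace GFP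
open Set Topology
open scoped unitInterval Topology.Homotopy

/-- A map from the unit sphere of a normed space to a contractible space extends to the whole
space. -/
theorem exists_continuous_extension {E X : Type*} [NormedAddCommGroup E] [NormedSpace ℝ E]
    [TopologicalSpace X] [ContractibleSpace X] {φ : E → X}
    (hφ : ContinuousOn φ (Metric.sphere 0 1)) : ∃ Φ : C(E, X), ∀ p, ‖p‖ = 1 → Φ p = φ p := by
  obtain ⟨x₀, ⟨F⟩⟩ := id_nullhomotopic X
  -- The contraction is run along the rays in the shell `1/2 ≤ ‖p‖ ≤ 1`, so that the map is
  -- constant on the ball of radius `1/2` and there is no problem at the origin.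
  let θ : E → I := fun p => Set.projIcc 0 1 zero_le_one (2 - 2 * ‖p‖)
  have hθ : Continuous θ := continuous_projIcc.comp (by fun_prop)
  have hcont : Continuous fun p : E =>
      if 1 / 2 ≤ ‖p‖ then F (θ p, φ (‖p‖⁻¹ • p)) else x₀ := by
    refine continuous_if_le continuous_const continuous_norm ?_ continuousOn_const ?_
    · refine F.continuous.comp_continuousOn (hθ.continuousOn.prodMk (hφ.comp ?_ ?_))
      · refine ContinuousOn.smul (continuous_norm.continuousOn.inv₀ ?_) continuousOn_id
        intro p hp h
        have : (1 : ℝ) / 2 ≤ ‖p‖ := hp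
        linarith
      · intro p hp
        have : (1 : ℝ) / 2 ≤ ‖p‖ := hp
        rw [mem_sphere_zero_iff_norm, norm_smul, norm_inv, norm_norm, inv_mul_cancel₀]
        intro h
        linarith
    · intro p hp
      have : θ p = 1 := by
        simp only [θ, ← hp]
        norm_num
      rw [this, F.apply_one]
      rfl
  refine ⟨⟨_, hcont⟩, fun p hp => ?_⟩
  have : θ p = 0 := by
    simp only [θ, hp]
    norm_num
  simp only [ContinuousMap.coe_mk, hp, this]
  rw [if_pos (by norm_num), F.apply_zero, inv_one, one_smul]
  rfl

/-- Generalized loops in a contractible space are trivial relative to the boundary of the cube. -/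
theorem genLoop_homotopic_const {n : ℕ} {X : Type*} [TopologicalSpace X] [ContractibleSpace X]
    {x : X} (f : Ω^ (Fin n) X x) : GenLoop.Homotopic f GenLoop.const := by
  -- The homotopy is an extension over `[-1, 1] × [-1, 1]ⁿ` of the map on the boundary that is
  -- `f` on the bottom face and constant elsewhere.
  let u : (Fin n → ℝ) → (Fin n → I) := fun p i => Set.projIcc 0 1 zero_le_one ((p i + 1) / 2)
  have hu : Continuous u := continuous_pi fun i => continuous_projIcc.comp (by fun_prop)
  have hub : ∀ p : Fin n → ℝ, ‖p‖ = 1 → u p ∈ Cube.boundary (Fin n) := by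
    intro p hp
    by_contra hb
    have : ‖p‖ < 1 := by
      rw [pi_norm_lt_iff zero_lt_one]
      intro i
      by_contra hi
      apply hb
      refine ⟨i, ?_⟩
      rw [not_lt, Real.norm_eq_abs, le_abs] at hi
      rcases hi with hi | hi
      · exact Or.inr (Set.projIcc_of_right_le _ (by linarith))
      · exact Or.inl (Set.projIcc_of_le_left _ (by linarith))
    exact this.ne hp
  let φ : ℝ × (Fin n → ℝ) → X := fun p => if p.1 ≤ -1 then f (u p.2) else x
  have hφ : ContinuousOn φ (Metric.sphere 0 1) := by
    have h1 : ContinuousOn φ (Metric.sphere 0 1 ∩ {p | p.1 ≤ -1}) := by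
      refine ContinuousOn.congr (f := fun p => f (u p.2)) ?_ fun p hp =>
        if_pos (show p.1 ≤ -1 from hp.2)
      exact (f.1.continuous.comp (hu.comp continuous_snd)).continuousOn
    have h2 : ContinuousOn φ (Metric.sphere 0 1 ∩ ({p | 1 ≤ ‖p.2‖} ∪ {p | 1 ≤ p.1})) := by
      refine ContinuousOn.congr (f := fun _ => x) continuousOn_const fun p hp => ?_
      simp only [φ]
      split_ifs with h
      · rcases hp.2 with h' | h'
        · have h3 : ‖p.2‖ ≤ 1 := (norm_snd_le p).trans (mem_sphere_zero_iff_norm.1 hp.1).le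
          exact f.2 _ (hub _ (le_antisymm h3 h'))
        · have h3 : 1 ≤ p.1 := h'
          linarith
      · rfl
    refine (h1.union_of_isClosed h2 ?_ ?_).mono ?_
    · exact Metric.isClosed_sphere.inter (isClosed_le continuous_fst continuous_const)
    · exact Metric.isClosed_sphere.inter
        ((isClosed_le continuous_const continuous_snd.norm).union
          (isClosed_le continuous_const continuous_fst))
    · intro p hp
      rw [← inter_union_distrib_left]
      refine ⟨hp, ?_⟩
      rw [mem_sphere_zero_iff_norm, Prod.norm_def] at hp
      rcases le_total ‖p.1‖ ‖p.2‖ with h | h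
      · rw [max_eq_right h] at hp
        exact Or.inr (Or.inl hp.ge)
      · rw [max_eq_left h, Real.norm_eq_abs] at hp
        rcases eq_or_eq_neg_of_abs_eq hp with h | h
        · exact Or.inr (Or.inr h.ge)
        · exact Or.inl h.le
  obtain ⟨Φ, hΦ⟩ := exists_continuous_extension hφ
  let w : I × (Fin n → I) → ℝ × (Fin n → ℝ) := fun p =>
    (2 * (p.1 : ℝ) - 1, fun i => 2 * (p.2 i : ℝ) - 1)
  have hw : Continuous w := by fun_prop
  have huw : ∀ p, u (w p).2 = p.2 := by
    intro p
    funext i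
    simp only [u, w, sub_add_cancel]
    rw [mul_div_cancel_left₀ _ two_ne_zero]
    exact Set.projIcc_val _ _
  have hnI : ∀ t : I, ‖2 * (t : ℝ) - 1‖ ≤ 1 := fun t => by
    rw [Real.norm_eq_abs, abs_le]
    constructor <;> linarith [t.2.1, t.2.2]
  have hn2 : ∀ p, ‖(w p).2‖ ≤ 1 := fun p => (pi_norm_le_iff_of_nonneg zero_le_one).2 fun i => hnI _
  have hn1 : ∀ p, ‖(w p).1‖ ≤ 1 := fun p => hnI _
  have hface : ∀ p, ‖(w p).1‖ = 1 → Φ (w p) = φ (w p) := fun p hp =>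
    hΦ _ (by rw [Prod.norm_def, hp]; exact max_eq_left (hn2 p))
  refine ⟨⟨⟨⟨Φ ∘ w, Φ.continuous.comp hw⟩, fun p => ?_, fun p => ?_⟩, fun t p hp => ?_⟩⟩
  · change Φ (w (0, p)) = f p
    rw [hface _ (by simp [w])]
    simp only [φ]
    rw [if_pos (by simp [w]), huw]
  · change Φ (w (1, p)) = x
    rw [hface _ (by norm_num [w])]
    simp only [φ]
    rw [if_neg (by norm_num [w])]
  · change Φ (w (t, p)) = f p
    have hp2 : ‖(w (t, p)).2‖ = 1 := by
      refine le_antisymm (hn2 _) ?_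
      obtain ⟨i, hi⟩ := hp
      refine le_trans ?_ (norm_le_pi_norm _ i)
      rcases hi with hi | hi <;> norm_num [w, hi]
    rw [hΦ _ (by rw [Prod.norm_def, hp2]; exact max_eq_right (hn1 _))]
    simp only [φ]
    rw [huw]
    split_ifs
    · rfl
    · exact (f.2 p hp).symm

/-- Two points of the boundary of a cube of dimension at least two cannot be told apart by a map
that is constant along connected subsets of the boundary. -/
theorem eq_of_mem_cube_boundary {n : ℕ} (hn : 2 ≤ n) {E : Type*} (g : (Fin n → I) → E)
    (hg : ∀ γ : C(I, Fin n → I), (∀ t, γ t ∈ Cube.boundary (Fin n)) → g (γ 1) = g (γ 0))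
    {y : Fin n → I} (hy : y ∈ Cube.boundary (Fin n)) : g y = g 0 := by
  obtain ⟨i, hi⟩ := hy
  have : Nontrivial (Fin n) := Fin.nontrivial_iff_two_le.2 hn
  obtain ⟨j, hj⟩ := exists_ne i
  -- shrink the coordinates other than `i`, and then the coordinate `i`
  let γ₁ : C(I, Fin n → I) := ⟨fun t k => if k = i then y k else t * y k,
    continuous_pi fun k => by split_ifs <;> fun_prop⟩
  let γ₂ : C(I, Fin n → I) := ⟨fun t k => if k = i then t * y k else 0,
    continuous_pi fun k => by split_ifs <;> fun_prop⟩
  have h1 := hg γ₁ fun t => ⟨i, by simpa [γ₁] using hi⟩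
  have h2 := hg γ₂ fun t => ⟨j, Or.inl (by simp [γ₂, hj])⟩
  have e1 : γ₁ 1 = y := by funext k; simp [γ₁]
  have e2 : γ₁ 0 = γ₂ 1 := by funext k; simp [γ₁, γ₂]
  have e3 : γ₂ 0 = 0 := by funext k; simp [γ₂]
  rw [← e1, h1, e2, h2, e3]

/-- The higher homotopy groups of a space with a contractible covering vanish. -/
theorem _root_.IsCoveringMap.subsingleton_homotopyGroup {E Y : Type*} [TopologicalSpace E]
    [TopologicalSpace Y] [ContractibleSpace E] {q : E → Y} (hq : IsCoveringMap q)
    (hs : Function.Surjective q) (y : Y) {n : ℕ} (hn : 2 ≤ n) :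
    Subsingleton (HomotopyGroup.Pi n Y y) := by
  obtain ⟨e, rfl⟩ := hs y
  suffices ∀ f : Ω^ (Fin n) Y (q e), GenLoop.Homotopic f GenLoop.const by
    refine ⟨fun a b => ?_⟩
    induction a using Quotient.inductionOn with | _ a => ?_
    induction b using Quotient.inductionOn with | _ b => ?_
    exact Quotient.sound ((this a).trans (this b).symm)
  intro f
  have h0 : (0 : Fin n → I) ∈ Cube.boundary (Fin n) := ⟨⟨0, by omega⟩, Or.inl rfl⟩
  -- lift the contraction of the cube to its corner
  let H : C(I × (Fin n → I), Y) :=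
    f.1.comp ⟨fun p i => p.1 * p.2 i, by fun_prop⟩
  have hH0 : ∀ p, H (0, p) = q ((ContinuousMap.const (Fin n → I) e) p) := by
    intro p
    refine Eq.trans ?_ (f.2 0 h0)
    exact congrArg f (by funext i; simp)
  let g : C(Fin n → I, E) :=
    (hq.liftHomotopy H _ hH0).comp ((ContinuousMap.const _ 1).prodMk (ContinuousMap.id _))
  have hg : ∀ p, q (g p) = f p := by
    intro p
    refine (congrFun (hq.liftHomotopy_lifts H _ hH0) (1, p)).trans ?_
    exact congrArg f (by funext i; simp)
  have hgb : ∀ p ∈ Cube.boundary (Fin n), g p = g 0 := by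
    refine fun p hp => eq_of_mem_cube_boundary hn g (fun γ hγ => ?_) hp
    refine hq.const_of_comp (g := g ∘ γ) (g.continuous.comp γ.continuous) (fun a b => ?_) 1 0
    simp only [Function.comp_apply, hg]
    exact (f.2 _ (hγ a)).trans (f.2 _ (hγ b)).symm
  obtain ⟨F⟩ := genLoop_homotopic_const (⟨g, hgb⟩ : Ω^ (Fin n) E (g 0))
  refine ⟨⟨⟨⟨q ∘ F, hq.continuous.comp F.continuous⟩, fun p => ?_, fun p => ?_⟩, fun t p hp => ?_⟩⟩
  · change q (F (0, p)) = f p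
    rw [F.apply_zero]
    exact hg p
  · change q (F (1, p)) = q e
    rw [F.apply_one]
    exact (hg 0).trans (f.2 0 h0)
  · change q (F (t, p)) = f p
    rw [F.eq_fst t hp]
    exact hg p

/-- A finite CW complex that is the quotient of a contractible space by a covering action of `Γ`
is a finite Eilenberg–MacLane space for `Γ`. -/
theorem HasFiniteEilenbergMacLane.of_isQuotientCoveringMap {Γ : Type*} [Group Γ] {E : Type*}
    {Y : Type} [TopologicalSpace E] [TopologicalSpace Y] [ContractibleSpace E] [MulAction Γ E]
    {q : E → Y} (hq : IsQuotientCoveringMap q Γ) [T2Space Y]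
    [cw : CWComplex (Set.univ : Set Y)] (hfin : CWComplex.Finite (Set.univ : Set Y)) :
    HasFiniteEilenbergMacLane Γ := by
  obtain ⟨e⟩ : Nonempty E := inferInstance
  have : PathConnectedSpace Y := hq.surjective.pathConnectedSpace hq.continuous
  refine ⟨Y, inferInstance, cw, q e, inferInstance, hfin, inferInstance,
    ⟨(hq.fundamentalGroupEquiv ⟨e, rfl⟩).trans (MulEquiv.inv' Γ).symm⟩,
    fun n hn => hq.isCoveringMap.subsingleton_homotopyGroup hq.surjective _ hn⟩

end GFP

/-! ### Simplicial actions on realizations -/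

namespace GFP
open Set Topology

universe v
variable {V : Type v} {K : PreAbstractSimplicialComplex V}

namespace Realization

/-- A map into a single closed simplex is continuous as soon as its barycentric coordinates are. -/
theorem continuous_of_weight {Z : Type*} [TopologicalSpace Z] {f : Z → Realization K} (s : K.faces)
    (hs : ∀ z, (f z).weight.support ⊆ s.1) (hf : ∀ a, Continuous fun z => (f z).weight a) :
    Continuous f := by
  have : f = simplexMap K s ∘ fun z => ⟨fun a => (f z).weight a, fun a => (f z).weight_nonneg a, by
      rw [← sum_weight_eq (f z) (hs z)]
      exact Finset.sum_coe_sort s.1 fun a => (f z).weight a⟩ := by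
    funext z
    ext a
    rw [Function.comp_apply, simplexMap_weight]
    split_ifs with h
    · rfl
    · exact Finsupp.notMem_support_iff.1 fun h' => h (hs z h')
  rw [this]
  refine (continuous_simplexMap s).comp (Continuous.subtype_mk ?_ _)
  exact continuous_pi fun a => hf a

theorem ext_weight {p q : Realization K} (h : ∀ a, p.weight a = q.weight a) : p = q :=
  Realization.ext (Finsupp.ext h)

instance : T2Space (Realization K) :=
  T2Space.of_injective_continuous (f := fun (p : Realization K) (a : V) => p.weight a)
    (fun _ _ h => ext_weight fun a => congrFun h a) (continuous_pi continuous_weight)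

end Realization

/-- A group acts on the vertices so that faces of `K` are mapped to faces of `K`. -/
class IsSimplicialAction (Γ : Type*) [Group Γ] [MulAction Γ V]
    (K : PreAbstractSimplicialComplex V) : Prop where
  faceImage_mem : ∀ (g : Γ) (s : Finset V), s ∈ K.faces → faceImage g s ∈ K.faces

section Action

variable {Γ : Type*} [Group Γ] [MulAction Γ V]

theorem faceImage_one (s : Finset V) : faceImage (1 : Γ) s = s := by
  ext a; simp [mem_faceImage]

theorem faceImage_mul (g h : Γ) (s : Finset V) :
    faceImage (g * h) s = faceImage g (faceImage h s) := by
  ext a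
  simp only [mem_faceImage]
  constructor
  · rintro ⟨b, hb, rfl⟩
    exact ⟨h • b, ⟨b, hb, rfl⟩, (mul_smul _ _ _).symm⟩
  · rintro ⟨_, ⟨b, hb, rfl⟩, rfl⟩
    exact ⟨b, hb, mul_smul _ _ _⟩

theorem faceImage_inv_eq_iff {g : Γ} {s t : Finset V} :
    faceImage g⁻¹ s = t ↔ s = faceImage g t := by
  constructor
  · rintro rfl
    rw [← faceImage_mul, mul_inv_cancel, faceImage_one]
  · rintro rfl
    rw [← faceImage_mul, inv_mul_cancel, faceImage_one]

theorem card_faceImage (g : Γ) (s : Finset V) : (faceImage g s).card = s.card :=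
  Finset.card_map _

variable [IsSimplicialAction Γ K]

/-- The affine extension of the action on the vertices. -/
instance : MulAction Γ (Realization K) where
  smul g p :=
    { weight := Finsupp.equivMapDomain (MulAction.toPerm g) p.weight
      weight_nonneg := fun a => p.weight_nonneg _
      support_mem := IsSimplicialAction.faceImage_mem g _ p.support_mem
      sum_weight := by
        rw [← p.sum_weight, Finsupp.sum, Finsupp.sum]
        change ∑ a ∈ faceImage g p.weight.support, _ = _
        rw [faceImage, Finset.sum_map]
        exact Finset.sum_congr rfl fun a _ => by simp [Finsupp.equivMapDomain_apply] }
  one_smul p := Realization.ext_weight fun a => congrArg p.weight (by simp)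
  mul_smul g h p := Realization.ext_weight fun a => congrArg p.weight (by simp [mul_smul])

namespace Realization

theorem smul_weight (g : Γ) (p : Realization K) (a : V) : (g • p).weight a = p.weight (g⁻¹ • a) :=
  rfl

theorem smul_weight_smul (g : Γ) (p : Realization K) (a : V) :
    (g • p).weight (g • a) = p.weight a := by
  rw [smul_weight, inv_smul_smul]

theorem support_smul (g : Γ) (p : Realization K) :
    (g • p).weight.support = faceImage g p.weight.support := rfl

instance : ContinuousConstSMul Γ (Realization K) where
  continuous_const_smul g := by
    rw [continuous_iff]
    intro s
    refine continuous_of_weight ⟨_, IsSimplicialAction.faceImage_mem g _ s.2⟩ (fun q => ?_)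
      fun a => ?_
    · rw [Function.comp_apply, support_smul]
      exact Finset.map_subset_map.2 (support_simplexMap_subset s q)
    · exact (continuous_weight (g⁻¹ • a)).comp (continuous_simplexMap s)

/-- A neighbourhood of `p` of points whose weights are concentrated on the support of `p`. -/
def core (p : Realization K) (δ : ℝ) : Set (Realization K) :=
  {r | (∀ a ∈ p.weight.support, δ < r.weight a) ∧ 1 - δ < ∑ a ∈ p.weight.support, r.weight a}

theorem isOpen_core (p : Realization K) (δ : ℝ) : IsOpen (core p δ) := by
  refine IsOpen.inter ?_ ?_
  · have : {r : Realization K | ∀ a ∈ p.weight.support, δ < r.weight a} =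
        ⋂ a ∈ p.weight.support, {r : Realization K | δ < r.weight a} := by
      ext r; simp
    change IsOpen {r : Realization K | ∀ a ∈ p.weight.support, δ < r.weight a}
    rw [this]
    exact isOpen_biInter_finset fun a _ => isOpen_lt continuous_const (continuous_weight a)
  · exact isOpen_lt continuous_const (continuous_finsetSum _ fun a _ => continuous_weight a)

theorem exists_lt_weight (p : Realization K) :
    ∃ δ : ℝ, 0 < δ ∧ ∀ a ∈ p.weight.support, δ < p.weight a := by
  obtain ⟨a, ha, hmin⟩ := p.weight.support.exists_min_image p.weight p.support_nonempty
  have := p.weight_pos ha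
  exact ⟨p.weight a / 2, by linarith, fun b hb => by linarith [hmin b hb]⟩

theorem mem_core {p : Realization K} {δ : ℝ} (h0 : 0 < δ)
    (h : ∀ a ∈ p.weight.support, δ < p.weight a) : p ∈ core p δ :=
  ⟨h, by rw [sum_weight_eq p subset_rfl]; linarith⟩

theorem smul_mem_support_of_mem_core {p q r : Realization K} {δ : ℝ} {g : Γ} (hr : r ∈ core p δ)
    (hgr : g • r ∈ core q δ) {a : V} (ha : a ∈ p.weight.support) : g • a ∈ q.weight.support := by
  classical
  by_contra hna
  have h1 := hr.1 a ha
  have h2 := hgr.2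
  rw [← smul_weight_smul g] at h1
  have h3 : (g • r).weight (g • a) + ∑ b ∈ q.weight.support, (g • r).weight b ≤ 1 := by
    rw [← Finset.sum_insert hna, ← sum_weight_eq (g • r) (s := (g • r).weight.support ∪
      insert (g • a) q.weight.support) Finset.subset_union_left]
    exact Finset.sum_le_sum_of_subset_of_nonneg Finset.subset_union_right
      fun b _ _ => (g • r).weight_nonneg b
  linarith

/-- On the support of `p` all weights of `r` exceed `δ`, while the weights of `g r` outside of the
support of `q` are less than `δ`; the same holds with the roles of `p` and `q` exchanged. -/
theorem faceImage_support_of_mem_core {p q r : Realization K} {δ : ℝ} {g : Γ} (hr : r ∈ core p δ)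
    (hgr : g • r ∈ core q δ) : faceImage g p.weight.support = q.weight.support := by
  refine Finset.Subset.antisymm (fun b hb => ?_) (fun b hb => ?_)
  · obtain ⟨a, ha, rfl⟩ := mem_faceImage.1 hb
    exact smul_mem_support_of_mem_core hr hgr ha
  · refine mem_faceImage.2 ⟨g⁻¹ • b, ?_, smul_inv_smul _ _⟩
    exact smul_mem_support_of_mem_core hgr (by rwa [inv_smul_smul]) hb

end Realization

/-- If vertex transporters are finite, then only the identity of a torsion-free group maps a
nonempty finite set of vertices to itself. -/
theorem eq_one_of_faceImage_eq (hfin : ∀ a b : V, {g : Γ | g • a = b}.Finite)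
    (htf : ∀ g : Γ, IsOfFinOrder g → g = 1) {g : Γ} {s : Finset V} (hs : s.Nonempty)
    (hg : faceImage g s = s) : g = 1 := by
  obtain ⟨a, ha⟩ := hs
  refine htf g (finite_powers.1 ?_)
  refine ((Finset.finite_toSet s).biUnion fun b _ => hfin a b).subset ?_
  rintro _ ⟨n, rfl⟩
  have : ∀ n : ℕ, g ^ n • a ∈ s := by
    intro n
    induction n with
    | zero => simpa
    | succ n ih =>
      rw [pow_succ', mul_smul]
      nth_rewrite 1 [← hg]
      exact smul_mem_faceImage.2 ih
  simp only [mem_iUnion, mem_ofPred_eq, exists_prop]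
  exact ⟨_, this n, rfl⟩

theorem finite_setOf_faceImage_eq (hfin : ∀ a b : V, {g : Γ | g • a = b}.Finite) {s : Finset V}
    (hs : s.Nonempty) (t : Finset V) : {g : Γ | faceImage g s = t}.Finite := by
  obtain ⟨a, ha⟩ := hs
  refine ((Finset.finite_toSet t).biUnion fun b _ => hfin a b).subset ?_
  rintro g rfl
  simp only [mem_iUnion, mem_ofPred_eq, exists_prop]
  exact ⟨_, smul_mem_faceImage.2 ha, rfl⟩

open Realization

/-- The action on the realization is a covering action. -/
theorem isQuotientCoveringMap_mk (hfin : ∀ a b : V, {g : Γ | g • a = b}.Finite)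
    (htf : ∀ g : Γ, IsOfFinOrder g → g = 1) :
    IsQuotientCoveringMap (Quotient.mk (MulAction.orbitRel Γ (Realization K))) Γ where
  toIsQuotientMap := isQuotientMap_quotient_mk'
  continuous_const_smul := continuous_const_smul
  apply_eq_iff_mem_orbit := Quotient.eq''
  disjoint p := by
    obtain ⟨δ, h0, h⟩ := p.exists_lt_weight
    refine ⟨core p δ, (isOpen_core p δ).mem_nhds (mem_core h0 h), ?_⟩
    rintro g ⟨_, ⟨r, hr, rfl⟩, hgr⟩
    exact eq_one_of_faceImage_eq hfin htf p.support_nonempty (faceImage_support_of_mem_core hr hgr)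

theorem t2Space_of_isQuotientCoveringMap (hfin : ∀ a b : V, {g : Γ | g • a = b}.Finite)
    {Y : Type*} [TopologicalSpace Y] {q : Realization K → Y} (hq : IsQuotientCoveringMap q Γ) :
    T2Space Y := by
  refine ⟨fun y z hyz => ?_⟩
  obtain ⟨p, rfl⟩ := hq.surjective y
  obtain ⟨r, rfl⟩ := hq.surjective z
  obtain ⟨δ₁, h1, h1'⟩ := p.exists_lt_weight
  obtain ⟨δ₂, h2, h2'⟩ := r.exists_lt_weight
  let δ := min δ₁ δ₂
  have h0 : 0 < δ := lt_min h1 h2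
  have hp := mem_core h0 fun a ha => (min_le_left _ _).trans_lt (h1' a ha)
  have hr := mem_core h0 fun a ha => (min_le_right _ _).trans_lt (h2' a ha)
  have hne : ∀ g : Γ, g • p ≠ r := fun g h => hyz (by rw [← h, hq.map_smul])
  choose A B hA hB hpA hrB hAB using fun g : Γ => t2_separation (hne g)
  -- Only these finitely many `g` can map a point near `p` to a point near `r`.
  have hΦ := finite_setOf_faceImage_eq hfin p.support_nonempty r.weight.support
  refine ⟨q '' (core p δ ∩ ⋂ g ∈ {g : Γ | faceImage g p.weight.support = r.weight.support},
      (g • ·) ⁻¹' A g),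
    q '' (core r δ ∩ ⋂ g ∈ {g : Γ | faceImage g p.weight.support = r.weight.support}, B g),
    hq.isCoveringMap.isOpenMap _ ((isOpen_core p δ).inter (hΦ.isOpen_biInter fun g _ =>
      (hA g).preimage (continuous_const_smul g))),
    hq.isCoveringMap.isOpenMap _ ((isOpen_core r δ).inter (hΦ.isOpen_biInter fun g _ => hB g)),
    ⟨p, ⟨hp, mem_iInter₂.2 fun g _ => hpA g⟩, rfl⟩,
    ⟨r, ⟨hr, mem_iInter₂.2 fun g _ => hrB g⟩, rfl⟩, ?_⟩
  rw [Set.disjoint_left]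
  rintro _ ⟨p', ⟨hp', hpA'⟩, rfl⟩ ⟨r', ⟨hr', hrB'⟩, h⟩
  obtain ⟨g, rfl⟩ := hq.apply_eq_iff_mem_orbit.1 h
  have hg := faceImage_support_of_mem_core hp' hr'
  exact Set.disjoint_left.1 (hAB g) (mem_iInter₂.1 hpA' g hg) (mem_iInter₂.1 hrB' g hg)

/-- A cocompact quotient of a realization has at most continuum many points. -/
theorem small_quotient {D : Set (Finset V)} (hD : D.Finite)
    (hcov : ∀ s ∈ K.faces, ∃ g : Γ, ∃ t ∈ D, s = faceImage g t) :
    Small.{0} (Quotient (MulAction.orbitRel Γ (Realization K))) := by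
  have : Finite ↥(D ∩ K.faces) := (hD.inter_of_left _).to_subtype
  have : Small.{0} (Σ t : ↥(D ∩ K.faces), stdSimplex ℝ t.1) := inferInstance
  refine small_of_surjective (α := Σ t : ↥(D ∩ K.faces), stdSimplex ℝ t.1)
    (f := fun x => Quotient.mk _ (simplexMap K ⟨x.1.1, x.1.2.2⟩ x.2)) ?_
  intro y
  induction y using Quotient.inductionOn with | _ p => ?_
  obtain ⟨g, t, ht, h⟩ := hcov _ p.support_mem
  have h' := faceImage_inv_eq_iff.2 h
  have htK : t ∈ K.faces := h' ▸ IsSimplicialAction.faceImage_mem g⁻¹ _ p.support_mem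
  obtain ⟨x, hx⟩ := exists_simplexMap_eq (g⁻¹ • p) ⟨t, htK⟩ (by rw [support_smul, h'])
  refine ⟨⟨⟨t, ht, htK⟩, x⟩, Quotient.sound ?_⟩
  simp only [hx]
  exact ⟨g⁻¹, rfl⟩

end Action
end GFP

/-! ### The cell structure of the quotient -/

namespace GFP
open Set Topology Metric

/-- A parametrization of the simplex with vertex set `ι` by the closed ball, that matches the open
ball with the open simplex. -/
theorem exists_simplexChart {n : ℕ} (ι : Type*) [Fintype ι] (hι : Fintype.card ι = n + 1) :
    ∃ f : (Fin n → ℝ) → ι → ℝ, Continuous f ∧ Function.Injective f ∧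
      f '' closedBall 0 1 = stdSimplex ℝ ι ∧
      ∀ p ∈ closedBall (0 : Fin n → ℝ) 1, p ∈ ball (0 : Fin n → ℝ) 1 ↔ ∀ i, 0 < f p i := by
  classical
  obtain ⟨b⟩ : Nonempty (AffineBasis ι ℝ (Fin n → ℝ)) :=
    AffineBasis.exists_affineBasis_of_finiteDimensional (by simpa using hι)
  have hint := b.interior_convexHull
  have hcl : closure (convexHull ℝ (range b)) = convexHull ℝ (range b) :=
    (((finite_range b).isCompact_convexHull ℝ).isClosed).closure_eq
  obtain ⟨h, h1, h2, -⟩ := exists_homeomorph_image_interior_closure_frontier_eq_unitBall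
    (convex_convexHull ℝ (range b)) (interior_convexHull_nonempty_iff_affineSpan_eq_top.2 b.tot)
    (((finite_range b).isCompact_convexHull ℝ).isBounded)
  rw [hcl, b.convexHull_eq_nonneg_coord] at h2
  rw [hint] at h1
  let f : (Fin n → ℝ) → ι → ℝ := fun p i => b.coord i (h.symm p)
  refine ⟨f, continuous_pi fun i => (continuous_barycentric_coord b i).comp h.symm.continuous,
    fun p q hpq => h.symm.injective (b.ext_elem fun i => congrFun hpq i), ?_, fun p _ => ?_⟩
  · ext w
    constructor
    · rintro ⟨p, hp, rfl⟩
      rw [← h2] at hp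
      obtain ⟨x, hx, rfl⟩ := hp
      refine ⟨fun i => ?_, b.sum_coord_apply_eq_one _⟩
      simp only [f, h.symm_apply_apply]
      exact hx i
    · rintro ⟨hw0, hw1⟩
      let x := Finset.univ.affineCombination ℝ b w
      have hx : ∀ i, b.coord i x = w i := fun i =>
        b.coord_apply_combination_of_mem (Finset.mem_univ i) hw1
      refine ⟨h x, ?_, funext fun i => ?_⟩
      · rw [← h2]
        exact ⟨x, fun i => by rw [hx]; exact hw0 i, rfl⟩
      · simp only [f, h.symm_apply_apply, hx]
  · rw [← h1]
    constructor
    · rintro ⟨x, hx, rfl⟩ i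
      simp only [f, h.symm_apply_apply]
      exact hx i
    · intro hp
      exact ⟨h.symm p, hp, h.apply_symm_apply p⟩

/-- A continuous map on a compact set is a homeomorphism onto its image when it is restricted to a
subset on which it is injective and whose image is disjoint from that of the complement. -/
theorem continuousOn_invFunOn {A B : Type*} [TopologicalSpace A] [Nonempty A] [TopologicalSpace B]
    [T2Space B] {f : A → B} {s t : Set A} (ht : IsCompact t) (hst : s ⊆ t) (hf : ContinuousOn f t)
    (hinj : InjOn f s) (hdisj : ∀ a ∈ t, f a ∈ f '' s → a ∈ s) :
    ContinuousOn (Function.invFunOn f s) (f '' s) := by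
  rw [continuousOn_iff_isClosed]
  intro c hc
  refine ⟨f '' (t ∩ c), ((ht.inter_right hc).image_of_continuousOn
    (hf.mono inter_subset_left)).isClosed, ?_⟩
  ext b
  constructor
  · rintro ⟨hbc, hb⟩
    exact ⟨⟨_, ⟨hst (Function.invFunOn_mem hb), hbc⟩, Function.invFunOn_eq hb⟩, hb⟩
  · rintro ⟨⟨a, ⟨hat, hac⟩, rfl⟩, hb⟩
    refine ⟨?_, hb⟩
    have : Function.invFunOn f s (f a) = a :=
      hinj (Function.invFunOn_mem hb) (hdisj a hat hb) (Function.invFunOn_eq hb)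
    rw [mem_preimage, this]
    exact hac

universe v
variable {V : Type v} {K : PreAbstractSimplicialComplex V} {Γ : Type*} [Group Γ] [MulAction Γ V]

/-- The faces in a finite set that meets every orbit can be chosen to be a transversal. -/
theorem exists_transversal {D : Set (Finset V)} (hD : D.Finite)
    (hcov : ∀ s ∈ K.faces, ∃ g : Γ, ∃ t ∈ D, s = faceImage g t) :
    ∃ (N : ℕ) (rep : Fin N → K.faces), (∀ s ∈ K.faces, ∃ i, ∃ g : Γ, s = faceImage g (rep i).1) ∧
      ∀ i j, ∀ g : Γ, (rep i).1 = faceImage g (rep j).1 → i = j := by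
  let r : Setoid K.faces :=
    { r := fun s t => ∃ g : Γ, s.1 = faceImage g t.1
      iseqv :=
        { refl := fun s => ⟨1, (faceImage_one _).symm⟩
          symm := fun {s t} ⟨g, hg⟩ => ⟨g⁻¹, (faceImage_inv_eq_iff.2 hg).symm⟩
          trans := fun {s t u} ⟨g, hg⟩ ⟨h, hh⟩ => ⟨g * h, by rw [hg, hh, faceImage_mul]⟩ } }
  have : Finite D := hD.to_subtype
  choose! g t ht hg using hcov
  have : Finite (Quotient r) := by
    refine Finite.of_injective (β := D)
      (fun x => ⟨t x.out.1, ht _ x.out.2⟩) fun x y hxy => ?_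
    have h : t x.out.1 = t y.out.1 := congrArg Subtype.val hxy
    refine Quotient.out_equiv_out.1 ⟨g x.out.1 * (g y.out.1)⁻¹, ?_⟩
    rw [faceImage_mul, faceImage_inv_eq_iff.2 (hg _ y.out.2), ← h]
    exact hg _ x.out.2
  obtain ⟨N, ⟨e⟩⟩ := Finite.exists_equiv_fin (Quotient r)
  refine ⟨N, fun i => (e.symm i).out, fun s hs => ?_, fun i j g hg => ?_⟩
  · obtain ⟨g, hg⟩ := Quotient.mk_out (s := r) ⟨s, hs⟩
    refine ⟨e (Quotient.mk r ⟨s, hs⟩), g⁻¹, ?_⟩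
    beta_reduce
    rw [Equiv.symm_apply_apply]
    exact (faceImage_inv_eq_iff.2 hg).symm
  · exact e.symm.injective (Quotient.out_equiv_out.1 ⟨g, hg⟩)

open Realization

theorem simplexMap_injective (s : K.faces) : Function.Injective (simplexMap K s) := by
  intro x y h
  refine Subtype.ext (funext fun a => ?_)
  rw [← simplexMap_weight_of_mem s x a.2, ← simplexMap_weight_of_mem s y a.2, h]

/-- The quotient of a realization by a free cocompact simplicial action is a finite CW complex,
with one cell for each orbit of simplices. -/
theorem exists_finite_cwComplex [IsSimplicialAction Γ K]
    (hfree : ∀ (g : Γ) (s : Finset V), s.Nonempty → faceImage g s = s → g = 1)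
    {D : Set (Finset V)} (hD : D.Finite)
    (hcov : ∀ s ∈ K.faces, ∃ g : Γ, ∃ t ∈ D, s = faceImage g t)
    {Y : Type} [TopologicalSpace Y] [T2Space Y] {q : Realization K → Y}
    (hq : IsQuotientCoveringMap q Γ) :
    ∃ _ : CWComplex (univ : Set Y), CWComplex.Finite (univ : Set Y) := by
  obtain ⟨N, rep, hrep, hrep'⟩ := exists_transversal hD hcov
  let cell : ℕ → Type := fun n => {i : Fin N // (rep i).1.card = n + 1}
  have hchart : ∀ n (i : cell n), Fintype.card (rep i.1).1 = n + 1 := fun n i => by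
    rw [Fintype.card_coe, i.2]
  choose f hfc hfi hfs hfb using fun n (i : cell n) => exists_simplexChart (rep i.1).1 (hchart n i)
  have hmem : ∀ n i, ∀ p ∈ closedBall (0 : Fin n → ℝ) 1, f n i p ∈ stdSimplex ℝ (rep i.1).1 :=
    fun n i p hp => by rw [← hfs]; exact mem_image_of_mem _ hp
  -- the lifts of the characteristic maps
  have hex : ∀ n i, ∃ e : (Fin n → ℝ) → Realization K,
      ∀ p, ∀ hp : p ∈ closedBall (0 : Fin n → ℝ) 1,
        e p = simplexMap K (rep i.1) ⟨f n i p, hmem n i p hp⟩ := by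
    classical
    intro n i
    refine ⟨fun p => if hp : p ∈ closedBall (0 : Fin n → ℝ) 1 then
      simplexMap K (rep i.1) ⟨f n i p, hmem n i p hp⟩ else
      simplexMap K (rep i.1) ⟨f n i 0, hmem n i 0 (mem_closedBall_self zero_le_one)⟩,
      fun p hp => dif_pos hp⟩
  choose e he using hex
  have hec : ∀ n i, ContinuousOn (e n i) (closedBall 0 1) := by
    intro n i
    rw [continuousOn_iff_continuous_domRestrict]
    have : (closedBall (0 : Fin n → ℝ) 1).domRestrict (e n i) = simplexMap K (rep i.1) ∘
        fun p : closedBall (0 : Fin n → ℝ) 1 => ⟨f n i p, hmem n i p p.2⟩ :=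
      funext fun p => he n i p p.2
    rw [this]
    exact (continuous_simplexMap _).comp
      (((hfc n i).comp continuous_subtype_val).subtype_mk _)
  have hball : ∀ n i, ∀ p ∈ closedBall (0 : Fin n → ℝ) 1,
      p ∈ ball (0 : Fin n → ℝ) 1 ↔ (e n i p).weight.support = (rep i.1).1 := by
    intro n i p hp
    rw [hfb n i p hp, he n i p hp]
    constructor
    · intro h
      refine Finset.Subset.antisymm (support_simplexMap_subset _ _) fun a ha => ?_
      rw [Finsupp.mem_support_iff, simplexMap_weight_of_mem _ _ ha]
      exact (h _).ne'
    · intro h a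
      have ha := weight_pos _ (h.ge a.2)
      rwa [simplexMap_weight_of_mem _ _ a.2] at ha
  have hsub : ∀ n i, ∀ p ∈ closedBall (0 : Fin n → ℝ) 1,
      (e n i p).weight.support ⊆ (rep i.1).1 := by
    intro n i p hp
    rw [he n i p hp]
    exact support_simplexMap_subset _ _
  have hinj : ∀ n i, InjOn (e n i) (closedBall (0 : Fin n → ℝ) 1) := by
    intro n i p hp p' hp' h
    rw [he n i p hp, he n i p' hp'] at h
    exact hfi n i (congrArg Subtype.val (simplexMap_injective _ h))
  -- every point lies in an open cell, of the dimension of its support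
  have hsurj : ∀ x : Realization K, ∀ n, x.weight.support.card = n + 1 → ∃ i : cell n,
      ∃ p ∈ ball (0 : Fin n → ℝ) 1, q (e n i p) = q x := by
    intro x n hn
    obtain ⟨i, g, hg⟩ := hrep _ x.support_mem
    have hg' := faceImage_inv_eq_iff.2 hg
    have hi : (rep i).1.card = n + 1 := by rw [← hn, hg, card_faceImage]
    obtain ⟨y, hy⟩ := exists_simplexMap_eq (g⁻¹ • x) (rep i) (by rw [support_smul, hg'])
    obtain ⟨p, hp, hpy⟩ := (hfs n ⟨i, hi⟩).ge y.2
    have hep : e n ⟨i, hi⟩ p = g⁻¹ • x := by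
      rw [he n _ p hp, ← hy]
      exact congrArg _ (Subtype.ext hpy)
    refine ⟨⟨i, hi⟩, p, (hball n ⟨i, hi⟩ p hp).2 ?_, ?_⟩
    · rw [hep, support_smul, hg']
    · rw [hep, hq.map_smul]
  have hballsub : ∀ n, ball (0 : Fin n → ℝ) 1 ⊆ closedBall 0 1 := fun n => ball_subset_closedBall
  have hqinj : ∀ n i, InjOn (q ∘ e n i) (ball 0 1) := by
    intro n i p hp p' hp' h
    obtain ⟨g, hg⟩ := hq.apply_eq_iff_mem_orbit.1 h
    have h1 := (hball n i p (hballsub n hp)).1 hp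
    have h2 := (hball n i p' (hballsub n hp')).1 hp'
    have hg1 : faceImage g (rep i.1).1 = (rep i.1).1 := by
      rw [← h2, ← support_smul]
      exact (congrArg (fun x : Realization K => x.weight.support) hg).trans (h1.trans h2.symm)
    rw [hfree g _ (K.isRelLowerSet_faces.prop_of_mem (rep i.1).2) hg1] at hg
    exact hinj n i (hballsub n hp) (hballsub n hp') (by simpa using hg.symm)
  let map : ∀ n, cell n → PartialEquiv (Fin n → ℝ) Y := fun n i => (hqinj n i).toPartialEquiv
  have hmap : ∀ n i p, map n i p = q (e n i p) := fun n i p => rfl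
  have hcont : ∀ n i, ContinuousOn (q ∘ e n i) (closedBall 0 1) := fun n i =>
    hq.continuous.comp_continuousOn (hec n i)
  have hsymm : ∀ n i, ContinuousOn (map n i).symm (map n i).target := by
    intro n i
    refine continuousOn_invFunOn (isCompact_closedBall 0 1) (hballsub n) (hcont n i) (hqinj n i) ?_
    rintro p hp ⟨p', hp', h⟩
    obtain ⟨g, hg⟩ := hq.apply_eq_iff_mem_orbit.1 h
    rw [hball n i p hp]
    refine Finset.eq_of_subset_of_card_le (hsub n i p hp) ?_
    rw [← (hball n i p' (hballsub n hp')).1 hp', ← hg, support_smul, card_faceImage]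
  have hdisj : (univ : Set (Σ n, cell n)).PairwiseDisjoint
      (fun ni => map ni.1 ni.2 '' ball 0 1) := by
    rintro ⟨n, i⟩ - ⟨m, j⟩ - hne
    rw [Function.onFun, Set.disjoint_left]
    rintro _ ⟨p, hp, rfl⟩ ⟨p', hp', h⟩
    obtain ⟨g, hg⟩ := hq.apply_eq_iff_mem_orbit.1 h
    have h1 := (hball n i p (hballsub n hp)).1 hp
    have h2 := (hball m j p' (hballsub m hp')).1 hp'
    have hij : j.1 = i.1 := hrep' j.1 i.1 g (by rw [← h1, ← h2, ← support_smul, ← hg])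
    obtain ⟨i, hi⟩ := i
    obtain ⟨j, hj⟩ := j
    obtain rfl : j = i := hij
    obtain rfl : n = m := by omega
    exact hne rfl
  have hsphere : ∀ n i, MapsTo (map n i) (sphere 0 1)
      (⋃ (m < n) (j : cell m), map m j '' closedBall 0 1) := by
    intro n i p hp
    have hp' := sphere_subset_closedBall hp
    have hlt : (e n i p).weight.support.card < n + 1 := by
      rw [← i.2]
      refine Finset.card_lt_card ((hsub n i p hp').ssubset_of_ne fun h => ?_)
      exact sphere_disjoint_ball.le_bot ⟨hp, (hball n i p hp').2 h⟩
    obtain ⟨m, hm⟩ := Nat.exists_eq_succ_of_ne_zero (e n i p).support_nonempty.card_ne_zero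
    obtain ⟨j, p', hp', h⟩ := hsurj _ m hm
    simp only [mem_iUnion]
    exact ⟨m, by omega, j, p', hballsub m hp', h⟩
  have hunion : ⋃ (n : ℕ) (j : cell n), map n j '' closedBall 0 1 = univ := by
    refine eq_univ_of_forall fun y => ?_
    obtain ⟨x, rfl⟩ := hq.surjective y
    obtain ⟨m, hm⟩ := Nat.exists_eq_succ_of_ne_zero x.support_nonempty.card_ne_zero
    obtain ⟨j, p', hp', h⟩ := hsurj x m hm
    simp only [mem_iUnion]
    exact ⟨m, j, p', hballsub m hp', h⟩
  have hempty : ∀ᶠ n in Filter.atTop, IsEmpty (cell n) := by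
    refine Filter.eventually_atTop.2 ⟨∑ i, (rep i).1.card, fun n hn => ⟨fun i => ?_⟩⟩
    have := Finset.single_le_sum (f := fun i => (rep i).1.card) (fun _ _ => Nat.zero_le _)
      (Finset.mem_univ i.1)
    have := i.2
    omega
  exact ⟨CWComplex.mkFinite univ cell map hempty (fun n => inferInstance) (fun n i => rfl) hcont
    hsymm hdisj hsphere hunion, CWComplex.finite_mkFinite univ cell map hempty
    (fun n => inferInstance) (fun n i => rfl) hcont hsymm hdisj hsphere hunion⟩

/-- A torsion-free group that acts simplicially and cocompactly, with finite vertex transporters,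
on a complex with contractible realization has a finite Eilenberg–MacLane space. -/
theorem hasFiniteEilenbergMacLane_of_action [IsSimplicialAction Γ K]
    [ContractibleSpace (Realization K)] (hfin : ∀ a b : V, {g : Γ | g • a = b}.Finite)
    (htf : ∀ g : Γ, IsOfFinOrder g → g = 1) {D : Set (Finset V)} (hD : D.Finite)
    (hcov : ∀ s ∈ K.faces, ∃ g : Γ, ∃ t ∈ D, s = faceImage g t) :
    HasFiniteEilenbergMacLane Γ := by
  have hsmall := small_quotient (Γ := Γ) hD hcov
  have hq := (isQuotientCoveringMap_mk (K := K) hfin htf).homeomorph_comp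
    (Shrink.homeomorph.{0} (Quotient (MulAction.orbitRel Γ (Realization K))))
  have := t2Space_of_isQuotientCoveringMap hfin hq
  obtain ⟨cw, hcw⟩ := exists_finite_cwComplex
    (fun g s hs h => eq_one_of_faceImage_eq hfin htf hs h) hD hcov hq
  exact HasFiniteEilenbergMacLane.of_isQuotientCoveringMap hq hcw

end GFP

/-! ### Stabilizers are of type `VF` -/

namespace GFP
open Set

universe u v w

namespace PresentationFamily

variable {G : Type u} {X : Type w} [Group G] [MulAction G X] {cG : Coding G} {cX : Coding X}
  (P : PresentationFamily.{u, v, w} cG cX)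

theorem finite_transporter (a b : P.V) : {g : G | g • a = b}.Finite := by
  obtain ⟨a, rfl⟩ := P.cV.surjective_elt a
  obtain ⟨b, rfl⟩ := P.cV.surjective_elt b
  refine ((P.transporter (a, b)).finite_toSet.image cG.elt).subset fun g hg => ?_
  exact (P.transporter_spec a b g).1 hg

theorem finite_dom (x : cX.Code) : (P.dom x).faces.Finite := by
  classical
  refine ((P.domain x).finite_toSet.image fun l => (l.map P.cV.elt).toFinset).subset ?_
  intro s hs
  obtain ⟨l, hl, h⟩ := (P.dom_spec x s).1 hs
  exact ⟨l, hl, by ext a; simp [h]⟩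

include P in
theorem isTypeVF_stabilizer (hG : IsVirtuallyTorsionFree G) (x : X) :
    IsTypeVF (MulAction.stabilizer G x) := by
  obtain ⟨H, hH, htf⟩ := hG
  obtain ⟨x, rfl⟩ := cX.surjective_elt x
  let Γ := H.subgroupOf (MulAction.stabilizer G (cX.elt x))
  have hΓ : Γ.FiniteIndex := inferInstance
  refine ⟨Γ, hΓ, ?_⟩
  have := P.sub_contractible (cX.elt x)
  have : IsSimplicialAction Γ (P.sub (cX.elt x)) := ⟨fun g s hs => P.faceImage_mem_sub g.1.2 hs⟩
  have hinj : Function.Injective fun g : Γ => (g : G) := fun _ _ h => Subtype.ext (Subtype.ext h)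
  refine hasFiniteEilenbergMacLane_of_action (K := P.sub (cX.elt x)) (Γ := Γ)
    (D := (fun y : (MulAction.stabilizer G (cX.elt x) ⧸ Γ) × Finset P.V =>
      faceImage (y.1.out⁻¹ : MulAction.stabilizer G (cX.elt x)) y.2) ''
        (univ ×ˢ (P.dom x).faces)) ?_ ?_ ?_ ?_
  · exact fun a b => (P.finite_transporter a b).preimage hinj.injOn
  · intro g hg
    refine hinj (htf g g.2 ?_)
    exact ((MulAction.stabilizer G (cX.elt x)).subtype.comp Γ.subtype).isOfFinOrder hg
  · exact (finite_univ.prod (P.finite_dom x)).image _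
  · intro s hs
    obtain ⟨g, hg, t, ht, rfl⟩ := (P.dom_covers x s).1 hs
    -- `g = (g c) c⁻¹` with `g c` in `Γ`, where `c` represents the coset of `g⁻¹`
    let g' : MulAction.stabilizer G (cX.elt x) := ⟨g, hg⟩
    let c := (QuotientGroup.mk g'⁻¹ : MulAction.stabilizer G (cX.elt x) ⧸ Γ)
    have hc : c.out⁻¹ * g'⁻¹ ∈ Γ := QuotientGroup.eq.1 (Quotient.out_eq' c)
    refine ⟨⟨g' * c.out, by simpa using Γ.inv_mem hc⟩, _, ⟨(c, t), ⟨mem_univ _, ht⟩, rfl⟩, ?_⟩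
    change faceImage g' t = faceImage (g' * c.out) (faceImage c.out⁻¹ t)
    rw [← faceImage_mul, mul_inv_cancel_right]

end PresentationFamily
end GFP

theorem proposition3p2 {G : Type*} {X : Type*} [Group G] [MulAction G X]
    (cG : GFP.Coding G) (cX : GFP.Coding X) (P : GFP.PresentationFamily cG cX)
    (hG : GFP.IsVirtuallyTorsionFree G) :
    (∃ orbit : cX.Code × cX.Code → Option cG.Code, Computable orbit ∧
      ∀ x y : cX.Code,
        ((orbit (x, y)).isSome ↔ ∃ g : G, g • cX.elt x = cX.elt y) ∧
        ∀ c ∈ orbit (x, y), cG.elt c • cX.elt x = cX.elt y) ∧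
    (∃ pres : cX.Code → List cG.Code × List (List (ℕ × Bool)), Computable pres ∧
      ∀ x : cX.Code, GFP.IsFinitePresentation (MulAction.stabilizer G (cX.elt x))
        ((pres x).1.map cG.elt) (pres x).2) ∧
    (∀ x : X, GFP.IsTypeVF (MulAction.stabilizer G x)) :=
  ⟨P.exists_orbit_algorithm, P.exists_presentation_algorithm, P.isTypeVF_stabilizer hG⟩
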